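/- Let $V$ be a complex vector space of finite dimension $r$. A reflection of $V$ is an element $s\in GL(V)$ of finite order such that $\ker(s-\mathrm{Id})$ is a hyperplane. Let $W\subset GL(V)$ be an irreducible complex reflection group, i.e. a finite subgroup that is generated by reflections and acts irreducibly on $V$. Let $\mathcal{A}$ be the set of its reflecting hyperplanes (the hyperplanes $\ker(s-\mathrm{Id})$, $s\in W$ a reflection), $N$ the number of reflections in $W$, and $N^*=|\mathcal{A}|$. For $H\in\mathcal{A}$ let $e_H$ be the order of the pointwise stabilizer of $H$ in $W$, and let $l_H$ be a linear form on $V$ with kernel $H$. A system of basic invariants is a sequence $f=(f_1,\dots,f_r)$ of algebraically independent homogeneous polynomial functions on $V$ with $\mathbf{C}[V]^W=\mathbf{C}[f_1,\dots,f_r]$ and $\deg f_1\le\dots\le\deg f_r$. The numbers $d_i=\deg f_i$ do not depend on $f$ and are the degrees of $W$. The discriminant $\Delta_f\in\mathbf{C}[X_1,\dots,X_r]$ is the unique polynomial with $\Delta_f(f_1,\dots,f_r)=\prod_{H\in\mathcal{A}}l_H^{e_H}$. A polynomial $P\in\mathbf{C}[X_1,\dots,X_r]$ is monic in $X_i$ if,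 when it is viewed as a polynomial in $X_i$ with coefficients in the polynomial ring in the other variables, its leading coefficient is a non-zero scalar; the degree of that one-variable polynomial is the $X_i$-degree of $P$. An integer $d$ is a regular number for $W$ if it is the order of some $w\in W$ such that, for some root of unity $\zeta$, the eigenspace $\ker(w-\zeta\,\mathrm{Id})$ contains a vector lying on no hyperplane of $\mathcal{A}$. Let $i_0\in\{1,\dots,r\}$ and $d=d_{i_0}$. (i) The degree $d$ is a regular number for $W$ if and only if there exists a system of basic invariants $f$ such that $\Delta_f$ is monic in $X_{i_0}$. Moreover, for every system of basic invariants $f$ such that $\Delta_f$ is monic in $X_{i_0}$, the $X_{i_0}$-degree of $\Delta_f$ is $(N+N^*)/d$. (ii) Assume that $i_0$ is the only index $i\in\{1,\dots,r\}$ such that $d$ divides $d_i$. Then the following assertions are equivalent: $d$ is a regular number for $W$; there exists a system of basic invariants $f$ such that $\Delta_f$ is monic in $X_{i_0}$; for every system of basic invariants $f$, $\Delta_f$ is monic in $X_{i_0}$. -/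

import Mathlib

open Module

noncomputable section

namespace ComplexReflection

variable {V : Type*} [AddCommGroup V] [Module ℂ V]

/-! ### Reflections and reflection groups -/

/-- A complex reflection of `V`: an element of finite order of `GL(V)` such that
`ker (s - Id)` is a hyperplane (a maximal proper subspace). -/
def IsReflection (s : V ≃ₗ[ℂ] V) : Prop :=
  IsOfFinOrder s ∧ IsCoatom (LinearMap.ker ((s : V →ₗ[ℂ] V) - LinearMap.id))

/-- The tautological representation on `V` of a subgroup of `GL(V)`. -/
def naturalRep (W : Subgroup (V ≃ₗ[ℂ] V)) : Representation ℂ W V :=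
  LinearEquiv.automorphismGroup.toLinearMapMonoidHom.comp W.subtype

/-- An irreducible complex reflection group: a finite subgroup of `GL(V)`, generated by
reflections, for which `V` is an irreducible representation (in particular `V` is not zero). -/
structure IsIrreducibleReflectionGroup (W : Subgroup (V ≃ₗ[ℂ] V)) : Prop where
  finite : Finite W
  generated : Subgroup.closure {s : V ≃ₗ[ℂ] V | s ∈ W ∧ IsReflection s} = W
  irreducible : (naturalRep W).IsIrreducible

/-- The set of reflecting hyperplanes of `W`. -/
def hyperplanes (W : Subgroup (V ≃ₗ[ℂ] V)) : Set (Submodule ℂ V) :=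
  {H | ∃ s ∈ W, IsReflection s ∧ LinearMap.ker ((s : V →ₗ[ℂ] V) - LinearMap.id) = H}

/-- The number `N` of reflections in `W`. -/
def numReflections (W : Subgroup (V ≃ₗ[ℂ] V)) : ℕ :=
  Set.ncard {s : V ≃ₗ[ℂ] V | s ∈ W ∧ IsReflection s}

/-- The number `N*` of reflecting hyperplanes of `W`. -/
def numHyperplanes (W : Subgroup (V ≃ₗ[ℂ] V)) : ℕ :=
  Set.ncard (hyperplanes W)

/-- The order `e_H` of the pointwise fixator of `H` in `W`. -/
def fixatorOrder (W : Subgroup (V ≃ₗ[ℂ] V)) (H : Submodule ℂ V) : ℕ :=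
  Set.ncard {w : V ≃ₗ[ℂ] V | w ∈ W ∧ ∀ v ∈ H, w v = v}

/-! ### Regular vectors and regular numbers -/

/-- The set of regular vectors: those lying on no reflecting hyperplane. -/
def regularVectors (W : Subgroup (V ≃ₗ[ℂ] V)) : Set V :=
  {v | ∀ H ∈ hyperplanes W, v ∉ H}

/-- `w` is `ζ`-regular: the eigenspace `ker (w - ζ Id)` contains a regular vector. -/
def IsZetaRegular (W : Subgroup (V ≃ₗ[ℂ] V)) (ζ : ℂ) (w : V ≃ₗ[ℂ] V) : Prop :=
  ∃ v ∈ regularVectors W, w v = ζ • v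

/-- `d` is a regular number for `W`: it is the order of an element of `W` which is `ζ`-regular
for some root of unity `ζ`. -/
def IsRegularNumber (W : Subgroup (V ≃ₗ[ℂ] V)) (d : ℕ) : Prop :=
  ∃ w ∈ W, (∃ ζ : ℂ, IsOfFinOrder ζ ∧ IsZetaRegular W ζ w) ∧ orderOf w = d

/-! ### Polynomial functions and invariants -/

variable (V) in
/-- The linear forms on `V`, as a subspace of the algebra of all functions `V → ℂ`. -/
def linearForms : Submodule ℂ (V → ℂ) :=
  LinearMap.range (LinearMap.ltoFun ℂ V ℂ ℂ)

variable (V) in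
/-- The algebra `ℂ[V]` of polynomial functions on `V`. -/
def polynomialFunctions : Subalgebra ℂ (V → ℂ) :=
  Algebra.adjoin ℂ (linearForms V : Set (V → ℂ))

variable (V) in
/-- The polynomial functions on `V` that are homogeneous of degree `n`: the linear combinations of
products of `n` linear forms. -/
def homogeneousFunctions (n : ℕ) : Submodule ℂ (V → ℂ) :=
  linearForms V ^ n

/-- The algebra `ℂ[V]^W` of `W`-invariant polynomial functions on `V`. -/
def invariants (W : Subgroup (V ≃ₗ[ℂ] V)) : Subalgebra ℂ (V → ℂ) where
  carrier := {p | p ∈ polynomialFunctions V ∧ ∀ w ∈ W, ∀ v, p (w v) = p v}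
  mul_mem' := fun ha hb =>
    ⟨mul_mem ha.1 hb.1, fun w hw v => by simp [ha.2 w hw v, hb.2 w hw v]⟩
  add_mem' := fun ha hb =>
    ⟨add_mem ha.1 hb.1, fun w hw v => by simp [ha.2 w hw v, hb.2 w hw v]⟩
  algebraMap_mem' := fun c => ⟨Subalgebra.algebraMap_mem _ c, fun _ _ _ => rfl⟩

/-- `f = (f_1, …, f_r)` is a system of basic invariants of `W` with degrees `(d_1, …, d_r)`: the
`f_i` are algebraically independent, they generate `ℂ[V]^W`, each `f_i` is homogeneous of degree
`d_i`, and `d_1 ≤ … ≤ d_r`. -/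
structure IsBasicSystemWithDegrees (W : Subgroup (V ≃ₗ[ℂ] V))
    (d : Fin (finrank ℂ V) → ℕ) (f : Fin (finrank ℂ V) → V → ℂ) : Prop where
  algebraicIndependent : AlgebraicIndependent ℂ f
  adjoin_eq : Algebra.adjoin ℂ (Set.range f) = invariants W
  homogeneous : ∀ i, f i ∈ homogeneousFunctions V (d i)
  sorted : Monotone d

/-- `f` is a system of basic invariants of `W`. -/
def IsSystemOfBasicInvariants (W : Subgroup (V ≃ₗ[ℂ] V))
    (f : Fin (finrank ℂ V) → V → ℂ) : Prop :=
  ∃ d, IsBasicSystemWithDegrees W d f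

open Classical in
/-- The degrees `d_1 ≤ … ≤ d_r` of `W`: the degrees of a system of basic invariants (they do not
depend on the system, and every finite reflection group has one; the default `0` is for the other
groups). -/
def degrees (W : Subgroup (V ≃ₗ[ℂ] V)) : Fin (finrank ℂ V) → ℕ :=
  if h : ∃ d, ∃ f, IsBasicSystemWithDegrees W d f then h.choose else 0

/-! ### The discriminant -/

/-- `l` chooses for each reflecting hyperplane `H` of `W` a linear form with kernel `H`. -/
def IsChoiceOfForms (W : Subgroup (V ≃ₗ[ℂ] V)) (l : Submodule ℂ V → Dual ℂ V) : Prop :=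
  ∀ H ∈ hyperplanes W, LinearMap.ker (l H) = H

/-- The function `∏_H l_H ^ e_H` on `V`, the product being over the reflecting hyperplanes. -/
def discriminantFunction (W : Subgroup (V ≃ₗ[ℂ] V)) (l : Submodule ℂ V → Dual ℂ V) : V → ℂ :=
  ∏ᶠ H ∈ hyperplanes W, (fun v => l H v) ^ fixatorOrder W H

/-- The discriminant polynomial `Δ_f` of `W` with respect to a system `f` of basic invariants: the
preimage of `∏_H l_H ^ e_H` under the isomorphism `Φ_f : ℂ[X_1, …, X_r] → ℂ[V]^W`, `X_i ↦ f_i`. -/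
def discriminant (W : Subgroup (V ≃ₗ[ℂ] V)) (l : Submodule ℂ V → Dual ℂ V)
    (f : Fin (finrank ℂ V) → V → ℂ) : MvPolynomial (Fin (finrank ℂ V)) ℂ :=
  Function.invFun (MvPolynomial.aeval f : MvPolynomial (Fin (finrank ℂ V)) ℂ →ₐ[ℂ] (V → ℂ))
    (discriminantFunction W l)

/-! ### Monic polynomials -/

/-- The polynomial `P`, seen as a polynomial `P_{X_i}` in the single variable `X_i` with
coefficients in the polynomial ring in the other variables. -/
def asPolynomialIn {r : ℕ} (i : Fin r) (P : MvPolynomial (Fin r) ℂ) :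
    Polynomial (MvPolynomial {j : Fin r // j ≠ i} ℂ) :=
  MvPolynomial.optionEquivLeft ℂ {j : Fin r // j ≠ i}
    (MvPolynomial.rename (Equiv.optionSubtypeNe i).symm P)

/-- `P` is monic in `X_i`: the head coefficient of `P_{X_i}` is a (non-zero) scalar. -/
def IsMonicIn {r : ℕ} (i : Fin r) (P : MvPolynomial (Fin r) ℂ) : Prop :=
  ∃ c : ℂ, c ≠ 0 ∧ (asPolynomialIn i P).leadingCoeff = MvPolynomial.C c

end ComplexReflection

end

noncomputable section

namespace ComplexReflection

variable {V : Type*} [AddCommGroup V] [Module ℂ V]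

/-! ### Polynomial functions -/

/-! Fix a basic system `f` with degrees `d`. The map `f : V → ℂ^r` is onto and its fibres are the
W-orbits (`exists_apply_eq`, `exists_apply_eq_of_forall_eq`). The product of the l_H^{e_H} is
invariant, and it is homogeneous of degree N + N* because e_H - 1 reflections have hyperplane H.
Hence Δ_f is weighted homogeneous of weight N + N*. For reasons of weight, it is monic in X_i
exactly when it contains a pure power X_i^k, and then k d_i = N + N*. Equivalently, Δ_f does not
vanish identically on the X_i-axis: some regular vector is killed by all f_j with j ≠ i.

Monic implies regular: take v above the i-th unit vector; it is regular. If ζ is a primitive d_i-th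
root of unity, ζv lies in the same fibre, so wv = ζv for some w in W, and w has order d_i because
regular vectors have trivial stabilizers.

Regular implies monic: let wv = ζv with v regular and ζ of order d_i. Then f_j(v) = ζ^{d_j} f_j(v),
so f_j(v) = 0 unless d_i divides d_j; under the assumption of (ii) this is enough for every `f`. In
general the Jacobian is non-zero at v, so df_i(v) ≠ 0, and v can be moved inside its eigenspace
until f_i(v) ≠ 0 (`exists_regular_apply_ne_zero`). Subtracting multiples of powers of f_i from the
other f_j then makes them vanish at v (`exists_forall_apply_eq_zero`).

This rests on Steinberg's theorem on regular vectors (`jacobian_ne_zero`, `eq_one_of_apply_eq`) and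
on the theorem of Shephard-Todd and Chevalley (`exists_algebraicIndependent_adjoin_eq`), which
provides basic systems; both are proved here. -/

theorem linearForm_mem_linearForms (l : Dual ℂ V) : (fun v => l v) ∈ linearForms V :=
  ⟨l, rfl⟩

theorem linearForm_mem (l : Dual ℂ V) : (fun v => l v) ∈ polynomialFunctions V :=
  Algebra.subset_adjoin (linearForm_mem_linearForms l)

theorem const_mem_polynomialFunctions (c : ℂ) : (fun _ => c) ∈ polynomialFunctions V :=
  Subalgebra.algebraMap_mem _ c

theorem polynomialFunctions_induction {p : (f : V → ℂ) → f ∈ polynomialFunctions V → Prop}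
    (linear : ∀ l : Dual ℂ V, p (fun v => l v) (linearForm_mem l))
    (const : ∀ c : ℂ, p (fun _ => c) (const_mem_polynomialFunctions c))
    (add : ∀ f g hf hg, p f hf → p g hg → p (f + g) (add_mem hf hg))
    (mul : ∀ f g hf hg, p f hf → p g hg → p (f * g) (mul_mem hf hg))
    {f : V → ℂ} (hf : f ∈ polynomialFunctions V) : p f hf := by
  induction hf using Algebra.adjoin_induction with
  | mem x hx => obtain ⟨l, rfl⟩ := hx; exact linear l
  | algebraMap r => exact const r
  | add x y hx hy h1 h2 => exact add _ _ hx hy h1 h2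
  | mul x y hx hy h1 h2 => exact mul _ _ hx hy h1 h2

theorem comp_mem_polynomialFunctions {f : V → ℂ} (hf : f ∈ polynomialFunctions V)
    (w : V →ₗ[ℂ] V) : (fun v => f (w v)) ∈ polynomialFunctions V := by
  induction hf using polynomialFunctions_induction with
  | linear l => exact linearForm_mem (l ∘ₗ w)
  | const c => exact const_mem_polynomialFunctions c
  | add f g _ _ h1 h2 => exact add_mem h1 h2
  | mul f g _ _ h1 h2 => exact mul_mem h1 h2

theorem homogeneousFunctions_le (n : ℕ) {f : V → ℂ} (hf : f ∈ homogeneousFunctions V n) :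
    f ∈ polynomialFunctions V := by
  have h : linearForms V ^ n ≤ Subalgebra.toSubmodule (polynomialFunctions V) := by
    clear hf
    induction n with
    | zero =>
      rw [pow_zero, Submodule.one_le]
      exact one_mem (polynomialFunctions V)
    | succ n ih0 =>
      rw [pow_succ, Submodule.mul_le]
      intro a ha b hb
      exact mul_mem (S := Subalgebra ℂ (V → ℂ)) (s := polynomialFunctions V)
        (ih0 ha) (Algebra.subset_adjoin hb)
  exact h hf

theorem homogeneousFunctions_smul {n : ℕ} {f : V → ℂ} (hf : f ∈ homogeneousFunctions V n)
    (c : ℂ) (v : V) : f (c • v) = c ^ n * f v := by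
  induction n generalizing f with
  | zero =>
    rw [homogeneousFunctions, pow_zero, Submodule.mem_one] at hf
    obtain ⟨a, rfl⟩ := hf
    simp
  | succ n ih =>
    rw [homogeneousFunctions, pow_succ] at hf
    refine Submodule.mul_induction_on hf (fun a ha b hb => ?_) fun x y hx hy => ?_
    · obtain ⟨l, rfl⟩ := hb
      simp only [Pi.mul_apply, ih ha, LinearMap.ltoFun_apply, map_smul, smul_eq_mul]
      ring
    · simp only [Pi.add_apply, hx, hy]
      ring

theorem prod_mem_homogeneousFunctions {ι : Type*} (s : Finset ι) {n : ι → ℕ} {f : ι → V → ℂ}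
    (hf : ∀ i ∈ s, f i ∈ homogeneousFunctions V (n i)) :
    ∏ i ∈ s, f i ∈ homogeneousFunctions V (∑ i ∈ s, n i) := by
  classical
  induction s using Finset.induction_on with
  | empty => simp [homogeneousFunctions]
  | insert a s ha ih =>
    rw [Finset.prod_insert ha, Finset.sum_insert ha, homogeneousFunctions, pow_add]
    exact Submodule.mul_mem_mul (hf a (by simp)) (ih fun i hi => hf i (by simp [hi]))

/-! ### Differentials -/

open Classical in
/-- The differential at `v` of a function on `V` all of whose line derivatives exist and are
linear in the direction (`0` for the other functions). -/
def differential (g : V → ℂ) (v : V) : Dual ℂ V :=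
  if h : ∃ d : Dual ℂ V, ∀ u, HasLineDerivAt ℂ g (d u) v u then h.choose else 0

theorem differential_eq {g : V → ℂ} {v : V} {d : Dual ℂ V}
    (h : ∀ u, HasLineDerivAt ℂ g (d u) v u) : differential g v = d := by
  have h' : ∃ d : Dual ℂ V, ∀ u, HasLineDerivAt ℂ g (d u) v u := ⟨d, h⟩
  rw [differential, dif_pos h']
  ext u
  exact (h'.choose_spec u).unique (h u)

/-- Polynomial dependence on the point is carried through the induction so that Jacobians are
polynomial functions. -/
theorem exists_differential {g : V → ℂ} (hg : g ∈ polynomialFunctions V) :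
    ∃ d : V → Dual ℂ V, (∀ u, (fun v => d v u) ∈ polynomialFunctions V) ∧
      ∀ v u, HasLineDerivAt ℂ g (d v u) v u := by
  induction hg using polynomialFunctions_induction with
  | linear l =>
    refine ⟨fun _ => l, fun u => const_mem_polynomialFunctions _, fun v u => ?_⟩
    have : HasDerivAt (fun t : ℂ => l v + t * l u) (l u) 0 := by
      simpa using ((hasDerivAt_id (0 : ℂ)).mul_const (l u)).const_add (l v)
    simpa [HasLineDerivAt] using this
  | const c =>
    exact ⟨fun _ => 0, fun u => const_mem_polynomialFunctions _,
      fun v u => by simpa [HasLineDerivAt] using hasDerivAt_const (0 : ℂ) c⟩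
  | add f g _ _ h1 h2 =>
    obtain ⟨d1, p1, h1⟩ := h1
    obtain ⟨d2, p2, h2⟩ := h2
    exact ⟨fun v => d1 v + d2 v, fun u => add_mem (p1 u) (p2 u),
      fun v u => HasDerivAt.add (h1 v u) (h2 v u)⟩
  | mul f g hf hg h1 h2 =>
    obtain ⟨d1, p1, h1⟩ := h1
    obtain ⟨d2, p2, h2⟩ := h2
    refine ⟨fun v => g v • d1 v + f v • d2 v,
      fun u => add_mem (mul_mem hg (p1 u)) (mul_mem hf (p2 u)), fun v u => ?_⟩
    have := HasDerivAt.mul (h1 v u) (h2 v u)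
    simp only [zero_smul, add_zero] at this
    refine (this.congr_deriv ?_ : HasDerivAt _ _ _)
    simp
    ring

theorem hasLineDerivAt_differential {g : V → ℂ} (hg : g ∈ polynomialFunctions V) (v u : V) :
    HasLineDerivAt ℂ g (differential g v u) v u := by
  obtain ⟨d, -, h⟩ := exists_differential hg
  rw [differential_eq (h v)]
  exact h v u

theorem differential_apply_mem {g : V → ℂ} (hg : g ∈ polynomialFunctions V) (u : V) :
    (fun v => differential g v u) ∈ polynomialFunctions V := by
  obtain ⟨d, hd, h⟩ := exists_differential hg
  simpa only [differential_eq (h _)] using hd u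

theorem differential_linear (l : Dual ℂ V) (v : V) : differential (fun v => l v) v = l :=
  differential_eq fun u => by
    have : HasDerivAt (fun t : ℂ => l v + t * l u) (l u) 0 := by
      simpa using ((hasDerivAt_id (0 : ℂ)).mul_const (l u)).const_add (l v)
    simpa [HasLineDerivAt] using this

theorem differential_const (c : ℂ) (v : V) : differential (fun _ => c) v = 0 :=
  differential_eq fun u => by simpa [HasLineDerivAt] using hasDerivAt_const (0 : ℂ) c

theorem differential_add {f g : V → ℂ} (hf : f ∈ polynomialFunctions V)
    (hg : g ∈ polynomialFunctions V) (v : V) :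
    differential (f + g) v = differential f v + differential g v :=
  differential_eq fun u =>
    HasDerivAt.add (hasLineDerivAt_differential hf v u) (hasLineDerivAt_differential hg v u)

theorem differential_mul {f g : V → ℂ} (hf : f ∈ polynomialFunctions V)
    (hg : g ∈ polynomialFunctions V) (v : V) :
    differential (f * g) v = g v • differential f v + f v • differential g v :=
  differential_eq fun u => by
    have := HasDerivAt.mul (hasLineDerivAt_differential hf v u)
      (hasLineDerivAt_differential hg v u)
    simp only [zero_smul, add_zero] at this
    refine (this.congr_deriv ?_ : HasDerivAt _ _ _)
    simp
    ring

theorem differential_sum {ι : Type*} (s : Finset ι) {f : ι → V → ℂ}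
    (hf : ∀ i ∈ s, f i ∈ polynomialFunctions V) (v : V) :
    differential (∑ i ∈ s, f i) v = ∑ i ∈ s, differential (f i) v := by
  classical
  induction s using Finset.induction_on with
  | empty => exact differential_const (V := V) 0 v
  | insert a s ha ih =>
    rw [Finset.sum_insert ha, Finset.sum_insert ha, differential_add (hf a (by simp))
      (sum_mem fun i hi => hf i (by simp [hi])), ih fun i hi => hf i (by simp [hi])]

theorem differential_comp {f : V → ℂ} (hf : f ∈ polynomialFunctions V) (w : V →ₗ[ℂ] V) (v : V) :
    differential (fun x => f (w x)) v = differential f (w v) ∘ₗ w :=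
  differential_eq fun u => by
    have := hasLineDerivAt_differential hf (w v) (w u)
    simpa [HasLineDerivAt] using this

/-! ### Coordinates -/

section Coordinates

variable [FiniteDimensional ℂ V]

variable (V) in
/-- The polynomial function defined by a polynomial in the coordinates of a basis of `V`. -/
def evalCoord : MvPolynomial (Fin (finrank ℂ V)) ℂ →ₐ[ℂ] (V → ℂ) :=
  MvPolynomial.aeval fun i v => (finBasis ℂ V).coord i v

theorem evalCoord_apply (p : MvPolynomial (Fin (finrank ℂ V)) ℂ) (v : V) :
    evalCoord V p v = MvPolynomial.aeval (fun i => (finBasis ℂ V).repr v i) p := by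
  have : ((Pi.evalAlgHom ℂ (fun _ : V => ℂ) v).comp (evalCoord V)) =
      MvPolynomial.aeval (fun i => (finBasis ℂ V).repr v i) := by
    ext i
    simp [evalCoord]
  exact DFunLike.congr_fun this p

theorem evalCoord_equivFun_symm (p : MvPolynomial (Fin (finrank ℂ V)) ℂ)
    (x : Fin (finrank ℂ V) → ℂ) :
    evalCoord V p ((finBasis ℂ V).equivFun.symm x) = MvPolynomial.aeval x p := by
  rw [evalCoord_apply]
  congr 2
  ext i
  exact congrFun ((finBasis ℂ V).equivFun.apply_symm_apply x) i

/-- Polynomial functions thus inherit unique factorization and the Nullstellensatz from the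
polynomial ring. -/
theorem evalCoord_injective : Function.Injective (evalCoord V) := by
  rw [injective_iff_map_eq_zero]
  intro p hp
  refine MvPolynomial.funext fun x => ?_
  have := congrFun hp ((finBasis ℂ V).equivFun.symm x)
  rw [evalCoord_equivFun_symm] at this
  simpa [MvPolynomial.coe_aeval_eq_eval] using this

/-- The linear polynomial that defines a linear form. -/
def linearPolynomial (l : Dual ℂ V) : MvPolynomial (Fin (finrank ℂ V)) ℂ :=
  ∑ i, MvPolynomial.C (l (finBasis ℂ V i)) * MvPolynomial.X i

theorem evalCoord_linearPolynomial (l : Dual ℂ V) :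
    evalCoord V (linearPolynomial l) = fun v => l v := by
  ext v
  rw [evalCoord_apply, linearPolynomial]
  conv_rhs => rw [← (finBasis ℂ V).sum_repr v]
  simp only [map_sum, map_mul, MvPolynomial.aeval_X, map_smul, smul_eq_mul,
    MvPolynomial.algHom_C, Algebra.algebraMap_self, RingHom.id_apply]
  exact Finset.sum_congr rfl fun i _ => mul_comm _ _

theorem linearPolynomial_isHomogeneous (l : Dual ℂ V) : (linearPolynomial l).IsHomogeneous 1 :=
  MvPolynomial.IsHomogeneous.sum _ _ _ fun i _ => by
    simpa using (MvPolynomial.isHomogeneous_C _ _).mul (MvPolynomial.isHomogeneous_X ℂ i)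

theorem evalCoord_mem (p : MvPolynomial (Fin (finrank ℂ V)) ℂ) :
    evalCoord V p ∈ polynomialFunctions V := by
  induction p using MvPolynomial.induction_on with
  | C a => simp [evalCoord]
  | add p q hp hq => rw [map_add]; exact add_mem hp hq
  | mul_X p i hp =>
    rw [map_mul]
    refine mul_mem hp ?_
    simpa [evalCoord] using linearForm_mem ((finBasis ℂ V).coord i)

theorem exists_evalCoord_eq {f : V → ℂ} (hf : f ∈ polynomialFunctions V) :
    ∃ p, evalCoord V p = f := by
  induction hf using polynomialFunctions_induction with
  | linear l => exact ⟨_, evalCoord_linearPolynomial l⟩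
  | const c => exact ⟨MvPolynomial.C c, by ext v; simp [evalCoord_apply]⟩
  | add f g _ _ h1 h2 =>
    obtain ⟨p, rfl⟩ := h1
    obtain ⟨q, rfl⟩ := h2
    exact ⟨p + q, map_add _ _ _⟩
  | mul f g _ _ h1 h2 =>
    obtain ⟨p, rfl⟩ := h1
    obtain ⟨q, rfl⟩ := h2
    exact ⟨p * q, map_mul _ _ _⟩

theorem evalCoord_mem_homogeneousFunctions {n : ℕ} {p : MvPolynomial (Fin (finrank ℂ V)) ℂ}
    (hp : p.IsHomogeneous n) : evalCoord V p ∈ homogeneousFunctions V n := by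
  rw [← p.support_sum_monomial_coeff, map_sum]
  refine sum_mem fun m hm => ?_
  have hdeg : m.sum (fun _ k => k) = n := by
    have := hp (MvPolynomial.mem_support_iff.1 hm)
    simpa [Finsupp.weight_apply] using this
  rw [evalCoord, MvPolynomial.aeval_monomial, ← Algebra.smul_def, ← hdeg]
  refine Submodule.smul_mem _ _ ?_
  exact prod_mem_homogeneousFunctions _ fun i _ =>
    Submodule.pow_mem_pow _ (linearForm_mem_linearForms ((finBasis ℂ V).coord i)) _

end Coordinates

/-! ### Generic points of hypersurfaces -/

section GenericPoints

variable [FiniteDimensional ℂ V]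

theorem exists_prime_dvd_evalCoord_eq_zero {p₀ : MvPolynomial (Fin (finrank ℂ V)) ℂ} (h₀ : p₀ ≠ 0)
    {v : V} (hv : evalCoord V p₀ v = 0) : ∃ p, Prime p ∧ p ∣ p₀ ∧ evalCoord V p v = 0 := by
  induction p₀ using UniqueFactorizationMonoid.induction_on_prime with
  | h₁ => exact absurd rfl h₀
  | h₂ x hx =>
    have h1 : IsUnit (evalCoord V x v) :=
      (hx.map (evalCoord V)).map (Pi.evalRingHom (fun _ : V => ℂ) v)
    exact absurd hv h1.ne_zero
  | h₃ a p ha hp ih =>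
    rw [map_mul, Pi.mul_apply, mul_eq_zero] at hv
    rcases hv with hv | hv
    · exact ⟨p, hp, dvd_mul_right _ _, hv⟩
    · obtain ⟨q, hq, hqa, hqv⟩ := ih ha hv
      exact ⟨q, hq, hqa.mul_left p, hqv⟩

/-- Total degrees add in a product and a prime has positive degree, so the cofactor is constant. -/
theorem exists_C_of_prime_dvd_linearPolynomial {p : MvPolynomial (Fin (finrank ℂ V)) ℂ}
    (hp : Prime p) {m : Dual ℂ V} (h : p ∣ linearPolynomial m) :
    ∃ a : ℂ, linearPolynomial m = p * MvPolynomial.C a := by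
  obtain ⟨q, hq⟩ := h
  by_cases hq0 : q = 0
  · exact ⟨0, by simp [hq, hq0]⟩
  have hdeg : p.totalDegree + q.totalDegree ≤ 1 := by
    rw [← MvPolynomial.totalDegree_mul_of_isDomain hp.ne_zero hq0, ← hq]
    exact (linearPolynomial_isHomogeneous m).totalDegree_le
  have hp1 : p.totalDegree ≠ 0 := by
    intro h0
    rw [MvPolynomial.totalDegree_eq_zero_iff_eq_C] at h0
    rw [h0] at hp
    refine hp.not_isUnit (IsUnit.map MvPolynomial.C (IsUnit.mk0 _ fun h => ?_))
    exact hp.ne_zero (by rw [h, map_zero])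
  have hq1 : q.totalDegree = 0 := by omega
  rw [MvPolynomial.totalDegree_eq_zero_iff_eq_C] at hq1
  exact ⟨_, hq1 ▸ hq⟩

/-- The hypersurface p = 0 passes through `v`, so it does not lie in `F`. If `v ∉ F`, a form killing
`F` but not `v` works. Otherwise `F` has codimension at least 2 and is killed by two independent
forms; `p` cannot divide both, since each would be a scalar multiple of `p`. -/
theorem exists_linearForm_not_dvd {p : MvPolynomial (Fin (finrank ℂ V)) ℂ} (hp : Prime p) {v : V}
    (hv : evalCoord V p v = 0) {F : Submodule ℂ V} (hF : F ≠ ⊤) (h : v ∉ F ∨ ¬ IsCoatom F) :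
    ∃ m : Dual ℂ V, (∀ x ∈ F, m x = 0) ∧ ¬ p ∣ linearPolynomial m := by
  rcases h with h | h
  · obtain ⟨m, hm, hmF⟩ := F.exists_dual_map_eq_bot_of_notMem h inferInstance
    refine ⟨m, fun x hx => ?_, fun ⟨q, hq⟩ => hm ?_⟩
    · have : m x ∈ F.map m := ⟨x, hx, rfl⟩
      rwa [hmF, Submodule.mem_bot] at this
    · have := congrFun (congrArg (evalCoord V) hq) v
      rw [evalCoord_linearPolynomial, map_mul, Pi.mul_apply, hv, zero_mul] at this
      exact this
  · have : ∃ G, F < G ∧ G ≠ ⊤ := by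
      by_contra! hG
      exact h ⟨hF, hG⟩
    obtain ⟨G, hFG, hG⟩ := this
    obtain ⟨x, hxG, hxF⟩ := SetLike.exists_of_lt hFG
    obtain ⟨y, -, hy⟩ := SetLike.exists_of_lt (lt_top_iff_ne_top.2 hG)
    obtain ⟨m, hmx, hmF⟩ := F.exists_dual_map_eq_bot_of_notMem hxF inferInstance
    obtain ⟨m', hmy, hmG⟩ := G.exists_dual_map_eq_bot_of_notMem hy inferInstance
    have hmF' : ∀ z ∈ F, m z = 0 := fun z hz => by
      have : m z ∈ F.map m := ⟨z, hz, rfl⟩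
      rwa [hmF, Submodule.mem_bot] at this
    have hmG' : ∀ z ∈ G, m' z = 0 := fun z hz => by
      have : m' z ∈ G.map m' := ⟨z, hz, rfl⟩
      rwa [hmG, Submodule.mem_bot] at this
    by_cases h1 : p ∣ linearPolynomial m
    · refine ⟨m', fun z hz => hmG' z (hFG.le hz), fun h2 => ?_⟩
      obtain ⟨a, ha⟩ := exists_C_of_prime_dvd_linearPolynomial hp h1
      obtain ⟨b, hb⟩ := exists_C_of_prime_dvd_linearPolynomial hp h2
      have ha' : ∀ z, m z = evalCoord V p z * a := fun z => by
        have := congrFun (congrArg (evalCoord V) ha) z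
        rw [evalCoord_linearPolynomial] at this
        simpa [evalCoord_apply] using this
      have hb' : ∀ z, m' z = evalCoord V p z * b := fun z => by
        have := congrFun (congrArg (evalCoord V) hb) z
        rw [evalCoord_linearPolynomial] at this
        simpa [evalCoord_apply] using this
      have hb0 : b ≠ 0 := fun h0 => hmy (by rw [hb', h0, mul_zero])
      have hpx : evalCoord V p x = 0 := by
        have := hb' x
        rw [hmG' x hxG] at this
        exact (mul_eq_zero.1 this.symm).resolve_right hb0
      exact hmx (by rw [ha', hpx, zero_mul])
    · exact ⟨m, hmF', h1⟩

/-- If a polynomial function vanishes at `v`, it vanishes at a point outside any finite union of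
proper subspaces that contains no hyperplane through `v`. -/
theorem exists_zero_forall_notMem {g : V → ℂ} (hg : g ∈ polynomialFunctions V) {v : V}
    (hv : g v = 0) {s : Set (Submodule ℂ V)} (hs : s.Finite) (hs_top : ∀ F ∈ s, F ≠ ⊤)
    (hsv : ∀ F ∈ s, v ∉ F ∨ ¬ IsCoatom F) : ∃ u, g u = 0 ∧ ∀ F ∈ s, u ∉ F := by
  obtain ⟨p₀, rfl⟩ := exists_evalCoord_eq hg
  by_cases h₀ : p₀ = 0
  · have := Subspace.biUnion_ne_univ_of_top_notMem (s := hs.toFinset) fun h => hs_top _ (by simpa using h) rfl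
    obtain ⟨u, hu⟩ := (Set.ne_univ_iff_exists_notMem _).1 this
    exact ⟨u, by simp [h₀], fun F hF huF => hu (Set.mem_biUnion (by simpa using hF) huF)⟩
  obtain ⟨p, hp, ⟨q, rfl⟩, hpv⟩ := exists_prime_dvd_evalCoord_eq_zero h₀ hv
  choose! m hm hmp using fun F (hF : F ∈ s) =>
    exists_linearForm_not_dvd hp hpv (hs_top F hF) (hsv F hF)
  -- The prime ideal (p) is the vanishing ideal of its zero locus by the Nullstellensatz. It does
  -- not contain the product of the forms, so some zero of `p` avoids the zeros of all of them.
  have hprod : ∏ F ∈ hs.toFinset, linearPolynomial (m F) ∉ Ideal.span {p} := by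
    rw [Ideal.mem_span_singleton, hp.dvd_finsetProd_iff]
    rintro ⟨F, hF, h⟩
    exact hmp F (by simpa using hF) h
  have : (Ideal.span {p}).IsPrime := (Ideal.span_singleton_prime hp.ne_zero).2 hp
  rw [← MvPolynomial.IsPrime.vanishingIdeal_zeroLocus (K := ℂ) (Ideal.span {p}),
    MvPolynomial.mem_vanishingIdeal_iff] at hprod
  push Not at hprod
  obtain ⟨x, hx, hxp⟩ := hprod
  have hpx : MvPolynomial.aeval x p = 0 :=
    MvPolynomial.mem_zeroLocus_iff.1 hx p (Ideal.mem_span_singleton_self p)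
  refine ⟨(finBasis ℂ V).equivFun.symm x, ?_, fun F hF hxF => hxp ?_⟩
  · rw [map_mul, Pi.mul_apply, evalCoord_equivFun_symm, hpx, zero_mul]
  · rw [map_prod]
    refine Finset.prod_eq_zero (i := F) (by simpa using hF) ?_
    rw [← evalCoord_equivFun_symm, evalCoord_linearPolynomial]
    exact hm F hF _ hxF

end GenericPoints

/-! ### Invariants and basic systems -/

section BasicSystems

variable {W : Subgroup (V ≃ₗ[ℂ] V)}

theorem mem_invariants {p : V → ℂ} :
    p ∈ invariants W ↔ p ∈ polynomialFunctions V ∧ ∀ w ∈ W, ∀ v, p (w v) = p v :=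
  Iff.rfl

variable (W) in
/-- The sum of the translates of a function under `W`. -/
def orbitSum [Fintype W] (g : V → ℂ) : V → ℂ := ∑ w : W, fun v => g (w.1 v)

theorem orbitSum_apply [Fintype W] (g : V → ℂ) (v : V) : orbitSum W g v = ∑ w : W, g (w.1 v) := by
  simp [orbitSum]

theorem orbitSum_mem_invariants [Fintype W] {g : V → ℂ} (hg : g ∈ polynomialFunctions V) :
    orbitSum W g ∈ invariants W := by
  refine ⟨sum_mem fun w _ => comp_mem_polynomialFunctions hg w.1.toLinearMap, fun w hw v => ?_⟩
  rw [orbitSum_apply, orbitSum_apply]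
  exact Equiv.sum_comp (Equiv.mulRight (⟨w, hw⟩ : W)) fun x : W => g (x.1 v)

/-- Invariant functions have arbitrary differentials, up to a scalar, at the points with trivial
stabilizer. -/
theorem exists_invariant_differential_eq [FiniteDimensional ℂ V] [Finite W] {u : V}
    (hu : ∀ w ∈ W, w u = u → w = 1) (l : Dual ℂ V) :
    ∃ F ∈ invariants W, ∃ c : ℂ, c ≠ 0 ∧ differential F u = c • l := by
  classical
  have := Fintype.ofFinite W
  -- A form separating `u` from its other translates; these are distinct from `u` since the
  -- stabilizer is trivial.
  obtain ⟨m, hm⟩ := Module.exists_dual_forall_apply_ne_zero (K := ℂ)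
    (fun w : {w : W // w ≠ 1} => u - w.1.1 u) fun w h => w.2 <| by
      have := hu w.1.1 w.1.2 (sub_eq_zero.1 h).symm
      exact Subtype.ext this
  set h : V → ℂ := ∏ w : {w : W // w ≠ 1}, fun x => m x - m (w.1.1 u) with hh
  have hlin (l : Dual ℂ V) (c : ℂ) : (fun x => l x - c) ∈ polynomialFunctions V :=
    sub_mem (linearForm_mem l) (const_mem_polynomialFunctions c)
  have hpoly : h ∈ polynomialFunctions V := prod_mem fun w _ => hlin m _
  have hu0 : h u ≠ 0 := by
    rw [hh, Finset.prod_apply]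
    exact Finset.prod_ne_zero_iff.2 fun w _ => by simpa using hm w
  have hw0 (w : W) (hw : w ≠ 1) : h (w.1 u) = 0 := by
    rw [hh, Finset.prod_apply]
    exact Finset.prod_eq_zero (Finset.mem_univ ⟨w, hw⟩) (sub_self _)
  -- The factor h² makes `g` vanish to second order at the translates of `u` other than `u`, so only
  -- w = 1 contributes to the differential of the orbit sum at `u`.
  set g : V → ℂ := (h * h) * fun x => l x - l u with hg
  have hgpoly : g ∈ polynomialFunctions V := mul_mem (mul_mem hpoly hpoly) (hlin l _)
  have hdl : differential (fun x => l x - l u) u = l := by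
    have : (fun x => l x - l u) = (fun x => l x) + fun _ => - l u := by
      ext; simp [sub_eq_add_neg]
    rw [this, differential_add (linearForm_mem l) (const_mem_polynomialFunctions _),
      differential_linear, differential_const, add_zero]
  refine ⟨orbitSum W g, orbitSum_mem_invariants hgpoly, h u * h u, mul_ne_zero hu0 hu0, ?_⟩
  rw [orbitSum, differential_sum _ fun w _ => comp_mem_polynomialFunctions hgpoly w.1.toLinearMap,
    Finset.sum_eq_single 1]
  · change differential g u = _
    rw [hg, differential_mul (mul_mem hpoly hpoly) (hlin l _), hdl]
    simp
  · intro w _ hw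
    have := differential_comp hgpoly w.1.toLinearMap u
    simp only [LinearEquiv.coe_coe] at this
    rw [this, hg, differential_mul (mul_mem hpoly hpoly) (hlin l _), differential_mul hpoly hpoly,
      Pi.mul_apply, hw0 w hw]
    simp
  · simp

/-- The Jacobian determinant of a sequence of functions. -/
def jacobian [FiniteDimensional ℂ V] (f : Fin (finrank ℂ V) → V → ℂ) (v : V) : ℂ :=
  Matrix.det (Matrix.of fun i j => differential (f i) v (finBasis ℂ V j))

variable {f : Fin (finrank ℂ V) → V → ℂ}

theorem jacobian_mem_polynomialFunctions [FiniteDimensional ℂ V] (hf : ∀ i, f i ∈ polynomialFunctions V) :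
    jacobian f ∈ polynomialFunctions V := by
  have : jacobian f = ∑ σ : Equiv.Perm (Fin (finrank ℂ V)),
      (Equiv.Perm.sign σ : ℤ) • ∏ i, fun v => differential (f (σ i)) v (finBasis ℂ V i) := by
    ext v
    simp [jacobian, Matrix.det_apply, Units.smul_def]
  rw [this]
  exact sum_mem fun σ _ => zsmul_mem (prod_mem fun i _ => differential_apply_mem (hf _) _) _

theorem jacobian_eq_zero_iff [FiniteDimensional ℂ V] {v : V} :
    jacobian f v = 0 ↔ ∃ x ≠ 0, ∀ i, differential (f i) v x = 0 := by
  rw [jacobian, ← Matrix.exists_mulVec_eq_zero_iff]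
  have key (c : Fin (finrank ℂ V) → ℂ) (i : Fin (finrank ℂ V)) :
      (Matrix.of fun i j => differential (f i) v (finBasis ℂ V j)).mulVec c i =
        differential (f i) v ((finBasis ℂ V).equivFun.symm c) := by
    simp [Matrix.mulVec, dotProduct, Basis.equivFun_symm_apply, mul_comm]
  constructor
  · rintro ⟨c, hc, h⟩
    exact ⟨(finBasis ℂ V).equivFun.symm c, (map_ne_zero_iff _ (LinearEquiv.injective _)).2 hc, fun i => by
      rw [← key, h, Pi.zero_apply]⟩
  · rintro ⟨x, hx, h⟩
    refine ⟨(finBasis ℂ V).equivFun x, by simpa using hx, funext fun i => ?_⟩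
    rw [key, LinearEquiv.symm_apply_apply, h, Pi.zero_apply]

/-! ### The Jacobian, the stabilizers and the quotient map of a basic system -/

namespace IsBasicSystemWithDegrees

variable {d : Fin (finrank ℂ V) → ℕ}

theorem mem_invariants (hf : IsBasicSystemWithDegrees W d f) (i) : f i ∈ invariants W :=
  hf.adjoin_eq ▸ Algebra.subset_adjoin ⟨i, rfl⟩

theorem mem_polynomialFunctions (hf : IsBasicSystemWithDegrees W d f) (i) :
    f i ∈ polynomialFunctions V :=
  (hf.mem_invariants i).1

theorem exists_aeval_eq (hf : IsBasicSystemWithDegrees W d f) {g : V → ℂ} (hg : g ∈ invariants W) :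
    ∃ P : MvPolynomial (Fin (finrank ℂ V)) ℂ, MvPolynomial.aeval f P = g := by
  rwa [← hf.adjoin_eq, Algebra.adjoin_range_eq_range_aeval] at hg

theorem differential_eq_zero (hf : IsBasicSystemWithDegrees W d f) {v x : V}
    (hx : ∀ i, differential (f i) v x = 0) {F : V → ℂ} (hF : F ∈ invariants W) :
    differential F v x = 0 := by
  have hle : Algebra.adjoin ℂ (Set.range f) ≤ polynomialFunctions V := fun g hg => by
    rw [hf.adjoin_eq] at hg
    exact hg.1
  rw [← hf.adjoin_eq] at hF
  induction hF using Algebra.adjoin_induction with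
  | mem g hg => obtain ⟨i, rfl⟩ := hg; exact hx i
  | algebraMap c => exact congrArg (· x) (differential_const c v)
  | add g h hg hh h1 h2 => rw [differential_add (hle hg) (hle hh), LinearMap.add_apply, h1, h2,
      add_zero]
  | mul g h hg hh h1 h2 => rw [differential_mul (hle hg) (hle hh)]; simp [h1, h2]

/-- A vector killed by all df_i(u) is killed by the differential at `u` of every invariant, and
those differentials fill the dual space. -/
theorem jacobian_ne_zero_of_free [FiniteDimensional ℂ V] [Finite W] (hf : IsBasicSystemWithDegrees W d f) {u : V}
    (hu : ∀ w ∈ W, w u = u → w = 1) : jacobian f u ≠ 0 := by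
  intro h
  obtain ⟨x, hx, hfx⟩ := jacobian_eq_zero_iff.1 h
  obtain ⟨l, hl⟩ := Module.exists_dual_forall_apply_ne_zero (K := ℂ) (fun _ : Unit => x)
    fun _ => hx
  obtain ⟨F, hF, c, hc, h⟩ := exists_invariant_differential_eq hu l
  have := hf.differential_eq_zero hfx hF
  rw [h, LinearMap.smul_apply, smul_eq_mul] at this
  exact mul_ne_zero hc (hl ()) this

/-- The Jacobian of a basic system does not vanish at the regular vectors. -/
theorem jacobian_ne_zero [FiniteDimensional ℂ V] [Finite W] (hf : IsBasicSystemWithDegrees W d f) {v : V}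
    (hv : v ∈ regularVectors W) : jacobian f v ≠ 0 := by
  intro h
  have hfix (w : V ≃ₗ[ℂ] V) (x : V) :
      x ∈ LinearMap.ker ((w : V →ₗ[ℂ] V) - LinearMap.id) ↔ w x = x := by
    simp [sub_eq_zero]
  -- The fixed spaces of the non-trivial elements. Those that are hyperplanes are reflecting
  -- hyperplanes and miss `v`; the others are too small to contain a hypersurface. A zero of the
  -- Jacobian at `v` would thus give a zero with trivial stabilizer.
  set s : Set (Submodule ℂ V) :=
    (fun w : V ≃ₗ[ℂ] V => LinearMap.ker ((w : V →ₗ[ℂ] V) - LinearMap.id)) ''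
      ((W : Set (V ≃ₗ[ℂ] V)) \ {1}) with hs
  have htop : ∀ F ∈ s, F ≠ ⊤ := by
    rintro _ ⟨w, ⟨-, hw1⟩, rfl⟩ htop
    exact hw1 (LinearEquiv.ext fun x => (hfix w x).1 (htop.ge Submodule.mem_top))
  have hreg : ∀ F ∈ s, v ∉ F ∨ ¬ IsCoatom F := by
    rintro _ ⟨w, ⟨hw, -⟩, rfl⟩
    by_contra! hcon
    have hfin : IsOfFinOrder w := by
      have := isOfFinOrder_of_finite (⟨w, hw⟩ : W)
      simpa using MonoidHom.isOfFinOrder W.subtype this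
    exact hv _ ⟨w, hw, ⟨hfin, hcon.2⟩, rfl⟩ hcon.1
  obtain ⟨u, hu, huF⟩ := exists_zero_forall_notMem
    (jacobian_mem_polynomialFunctions hf.mem_polynomialFunctions) h
    (((W : Set (V ≃ₗ[ℂ] V)).toFinite.sdiff).image _) htop hreg
  refine hf.jacobian_ne_zero_of_free (fun w hw hwu => ?_) hu
  by_contra hw1
  exact huF _ ⟨w, ⟨hw, hw1⟩, rfl⟩ ((hfix w u).2 hwu)

/-- The stabilizers of the regular vectors are trivial. -/
theorem eq_one_of_apply_eq [FiniteDimensional ℂ V] [Finite W] (hf : IsBasicSystemWithDegrees W d f) {v : V}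
    (hv : v ∈ regularVectors W) {w : V ≃ₗ[ℂ] V} (hw : w ∈ W) (hwv : w v = v) : w = 1 := by
  by_contra hw1
  have : ∃ x, w x ≠ x := by
    by_contra! h
    exact hw1 (LinearEquiv.ext h)
  obtain ⟨x, hx⟩ := this
  -- Since f_i is invariant and `w` fixes `v`, df_i(v) is unchanged by composition with `w`, so it
  -- kills w x - x.
  refine hf.jacobian_ne_zero hv (jacobian_eq_zero_iff.2 ⟨w x - x, sub_ne_zero.2 hx, fun i => ?_⟩)
  have h1 := differential_comp (hf.mem_polynomialFunctions i) w.toLinearMap v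
  have h2 : (fun y => f i (w.toLinearMap y)) = f i :=
    funext fun y => (hf.mem_invariants i).2 w hw y
  rw [h2, LinearEquiv.coe_coe, hwv] at h1
  rw [map_sub, sub_eq_zero]
  exact (LinearMap.congr_fun h1 x).symm

/-- The map `V → ℂ^r` defined by a basic system is surjective. -/
theorem exists_apply_eq [FiniteDimensional ℂ V] [Finite W] (hf : IsBasicSystemWithDegrees W d f)
    (a : Fin (finrank ℂ V) → ℂ) : ∃ v, ∀ i, f i v = a i := by
  by_contra! hcon
  have := Fintype.ofFinite W
  choose p hp using fun i => exists_evalCoord_eq (hf.mem_polynomialFunctions i)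
  set I : Ideal (MvPolynomial (Fin (finrank ℂ V)) ℂ) :=
    Ideal.span (Set.range fun i => p i - MvPolynomial.C (a i)) with hI
  -- If the fibre over `a` were empty, the Nullstellensatz would give 1 = ∑ c_i (f_i - a_i). Summing
  -- over `W` replaces the c_i by invariants Q_i(f), and algebraic independence gives ∑ Q_i (X_i -
  -- a_i) = |W|, which is absurd at X = a.
  have hItop : I = ⊤ := by
    rw [← Ideal.radical_eq_top, ← MvPolynomial.vanishingIdeal_zeroLocus_eq_radical (K := ℂ),
      Ideal.eq_top_iff_one, MvPolynomial.mem_vanishingIdeal_iff]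
    intro x hx
    obtain ⟨i, hi⟩ := hcon ((finBasis ℂ V).equivFun.symm x)
    have := MvPolynomial.mem_zeroLocus_iff.1 hx _ (Ideal.subset_span ⟨i, rfl⟩)
    rw [← evalCoord_equivFun_symm, map_sub, hp] at this
    refine absurd (sub_eq_zero.1 ?_) hi
    simpa [evalCoord_apply] using this
  have h1 : (1 : MvPolynomial (Fin (finrank ℂ V)) ℂ) ∈ I := hItop ▸ Submodule.mem_top
  rw [hI, Ideal.mem_span_range_iff_exists_fun] at h1
  obtain ⟨c, hc⟩ := h1
  choose Q hQ using fun i =>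
    hf.exists_aeval_eq (orbitSum_mem_invariants (W := W) (evalCoord_mem (c i)))
  have key : MvPolynomial.aeval f (∑ i, Q i * (MvPolynomial.X i - MvPolynomial.C (a i))) =
      MvPolynomial.aeval f (MvPolynomial.C (Fintype.card W : ℂ)) := by
    ext v
    simp only [map_sum, map_mul, map_sub, hQ, MvPolynomial.aeval_X, MvPolynomial.algHom_C,
      Finset.sum_apply, Pi.mul_apply, Pi.sub_apply, orbitSum_apply, Finset.sum_mul]
    rw [Finset.sum_comm]
    have (w : W) : ∑ i, evalCoord V (c i) (w.1 v) * (f i v - algebraMap ℂ (V → ℂ) (a i) v) = 1 := by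
      have := congrFun (congrArg (evalCoord V) hc) (w.1 v)
      simp only [map_sum, map_mul, map_sub, hp, Finset.sum_apply, Pi.mul_apply, Pi.sub_apply,
        map_one, Pi.one_apply, MvPolynomial.algHom_C, (hf.mem_invariants _).2 w.1 w.2] at this
      exact this
    simp only [Finset.sum_congr rfl fun w _ => this w]
    simp
  have := congrArg (MvPolynomial.eval a) (hf.algebraicIndependent key)
  simp only [map_sum, map_mul, map_sub, MvPolynomial.eval_X, MvPolynomial.eval_C, sub_self,
    mul_zero, Finset.sum_const_zero] at this
  exact Nat.cast_ne_zero.2 Fintype.card_ne_zero this.symm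

/-- A basic system separates the orbits. -/
theorem exists_apply_eq_of_forall_eq [Finite W] (hf : IsBasicSystemWithDegrees W d f) {v v' : V}
    (h : ∀ i, f i v = f i v') : ∃ w ∈ W, w v = v' := by
  classical
  by_contra! hcon
  have := Fintype.ofFinite W
  obtain ⟨m, hm⟩ := Module.exists_dual_forall_apply_ne_zero (K := ℂ)
    (fun w : W => w.1 v - v') fun w => sub_ne_zero.2 (hcon w.1 w.2)
  -- An invariant that vanishes at `v'` (the factor w = 1) but not at `v`, by the choice of `m`; as
  -- a polynomial in the f_i it would take equal values there.
  set F : V → ℂ := ∏ w : W, fun x => m (w.1 x) - m v' with hF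
  have hFinv : F ∈ invariants W := by
    refine ⟨prod_mem fun w _ => sub_mem (linearForm_mem (m ∘ₗ w.1.toLinearMap))
      (const_mem_polynomialFunctions _), fun w hw x => ?_⟩
    rw [hF, Finset.prod_apply, Finset.prod_apply]
    exact Equiv.prod_comp (Equiv.mulRight (⟨w, hw⟩ : W)) fun y : W => m (y.1 x) - m v'
  obtain ⟨P, hP⟩ := hf.exists_aeval_eq hFinv
  have heval (x : V) : F x = MvPolynomial.aeval (fun i => f i x) P := by
    rw [← hP]
    have : (Pi.evalAlgHom ℂ (fun _ : V => ℂ) x).comp (MvPolynomial.aeval f) =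
        MvPolynomial.aeval (fun i => f i x) := by
      ext i
      simp
    exact DFunLike.congr_fun this P
  have h0 : F v' = 0 := by
    rw [hF, Finset.prod_apply]
    exact Finset.prod_eq_zero (Finset.mem_univ 1) (sub_self _)
  rw [heval, ← funext h, ← heval, hF, Finset.prod_apply, Finset.prod_eq_zero_iff] at h0
  obtain ⟨w, -, hw⟩ := h0
  exact hm w (by simpa using hw)

end IsBasicSystemWithDegrees

end BasicSystems

/-! ### The discriminant function -/

section DiscriminantFunction

variable {W : Subgroup (V ≃ₗ[ℂ] V)}

theorem isOfFinOrder_of_mem [Finite W] {w : V ≃ₗ[ℂ] V} (hw : w ∈ W) : IsOfFinOrder w := by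
  simpa using MonoidHom.isOfFinOrder W.subtype (isOfFinOrder_of_finite (⟨w, hw⟩ : W))

theorem mem_ker_sub_id {w : V ≃ₗ[ℂ] V} {x : V} :
    x ∈ LinearMap.ker ((w : V →ₗ[ℂ] V) - LinearMap.id) ↔ w x = x := by
  simp [sub_eq_zero]

theorem hyperplanes_finite [Finite W] : (hyperplanes W).Finite := by
  refine ((W : Set (V ≃ₗ[ℂ] V)).toFinite.image
    fun s : V ≃ₗ[ℂ] V => LinearMap.ker ((s : V →ₗ[ℂ] V) - LinearMap.id)).subset ?_
  rintro H ⟨s, hs, -, rfl⟩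
  exact ⟨s, hs, rfl⟩

theorem isCoatom_of_mem_hyperplanes {H : Submodule ℂ V} (hH : H ∈ hyperplanes W) :
    IsCoatom H := by
  obtain ⟨s, -, h, rfl⟩ := hH
  exact h.2

theorem comap_mem_hyperplanes [Finite W] {w : V ≃ₗ[ℂ] V} (hw : w ∈ W) {H : Submodule ℂ V}
    (hH : H ∈ hyperplanes W) : H.comap w.toLinearMap ∈ hyperplanes W := by
  have hcoatom : IsCoatom (H.comap w.toLinearMap) := by
    have h := isCoatom_of_mem_hyperplanes hH
    rw [← (Submodule.orderIsoMapComap w).symm.isCoatom_iff] at h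
    exact h
  obtain ⟨t, ht, -, rfl⟩ := hH
  have hmem : w⁻¹ * t * w ∈ W := mul_mem (mul_mem (inv_mem hw) ht) hw
  have hker : LinearMap.ker (((w⁻¹ * t * w : V ≃ₗ[ℂ] V) : V →ₗ[ℂ] V) - LinearMap.id) =
      (LinearMap.ker ((t : V →ₗ[ℂ] V) - LinearMap.id)).comap w.toLinearMap := by
    ext x
    rw [mem_ker_sub_id, Submodule.mem_comap, mem_ker_sub_id]
    exact LinearEquiv.symm_apply_eq w
  exact ⟨_, hmem, ⟨isOfFinOrder_of_mem hmem, hker ▸ hcoatom⟩, hker⟩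

theorem fixatorOrder_comap {w : V ≃ₗ[ℂ] V} (hw : w ∈ W) (H : Submodule ℂ V) :
    fixatorOrder W (H.comap w.toLinearMap) = fixatorOrder W H := by
  rw [fixatorOrder, fixatorOrder,
    ← Set.ncard_image_of_injective _ (MulAut.conj w).injective]
  congr 1
  ext g
  simp only [Set.mem_image, Set.mem_ofPred_eq, MulAut.conj_apply, Submodule.mem_comap]
  constructor
  · rintro ⟨h, ⟨hh, hfix⟩, rfl⟩
    refine ⟨mul_mem (mul_mem hw hh) (inv_mem hw), fun v hv => ?_⟩
    have h1 : w (w.symm v) = v := w.apply_symm_apply v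
    have := hfix (w.symm v) (by rwa [LinearEquiv.coe_coe, h1])
    change w (h (w.symm v)) = v
    rw [this, h1]
  · rintro ⟨hg, hfix⟩
    refine ⟨w⁻¹ * g * w, ⟨mul_mem (mul_mem (inv_mem hw) hg) hw, fun v hv => ?_⟩, by group⟩
    change w.symm (g (w v)) = v
    exact (congrArg w.symm (hfix _ hv)).trans (w.symm_apply_apply v)

theorem fixatorOrder_pos [Finite W] (H : Submodule ℂ V) : 0 < fixatorOrder W H :=
  (Set.ncard_pos ((W : Set (V ≃ₗ[ℂ] V)).toFinite.subset fun _ h => h.1)).2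
    ⟨1, one_mem W, fun _ _ => rfl⟩

theorem eq_one_or_of_fixes [Finite W] {w : V ≃ₗ[ℂ] V} (hw : w ∈ W) {H : Submodule ℂ V}
    (hH : H ∈ hyperplanes W) (h : ∀ v ∈ H, w v = v) :
    w = 1 ∨ IsReflection w ∧ LinearMap.ker ((w : V →ₗ[ℂ] V) - LinearMap.id) = H := by
  by_cases hw1 : w = 1
  · exact Or.inl hw1
  have hle : H ≤ LinearMap.ker ((w : V →ₗ[ℂ] V) - LinearMap.id) :=
    fun v hv => mem_ker_sub_id.2 (h v hv)
  have hcoatom := isCoatom_of_mem_hyperplanes hH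
  rcases hcoatom.le_iff.1 hle with htop | heq
  · exact absurd (LinearEquiv.ext fun x => mem_ker_sub_id.1 (htop.ge Submodule.mem_top)) hw1
  · exact Or.inr ⟨⟨isOfFinOrder_of_mem hw, heq ▸ hcoatom⟩, heq⟩

/-- The pointwise fixator of `H` consists of 1 and the reflections with hyperplane `H`: the
reflections add up to N and the identities to N*. -/
theorem sum_fixatorOrder [Finite W] :
    ∑ H ∈ (hyperplanes_finite (W := W)).toFinset, fixatorOrder W H =
      numReflections W + numHyperplanes W := by
  classical
  have hRfin : {s : V ≃ₗ[ℂ] V | s ∈ W ∧ IsReflection s}.Finite :=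
    (W : Set (V ≃ₗ[ℂ] V)).toFinite.subset fun _ h => h.1
  have hN : numReflections W = hRfin.toFinset.card := Set.ncard_eq_toFinset_card _ hRfin
  have hN' : numHyperplanes W = ∑ H ∈ (hyperplanes_finite (W := W)).toFinset, 1 := by
    rw [numHyperplanes, Set.ncard_eq_toFinset_card _ hyperplanes_finite, Finset.card_eq_sum_ones]
  rw [hN, hN', Finset.card_eq_sum_card_fiberwise
    (f := fun s : V ≃ₗ[ℂ] V => LinearMap.ker ((s : V →ₗ[ℂ] V) - LinearMap.id))
    (t := (hyperplanes_finite (W := W)).toFinset), ← Finset.sum_add_distrib]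
  · refine Finset.sum_congr rfl fun H hH => ?_
    rw [Set.Finite.mem_toFinset] at hH
    have hnotin : (1 : V ≃ₗ[ℂ] V) ∉ hRfin.toFinset.filter
        fun s : V ≃ₗ[ℂ] V => LinearMap.ker ((s : V →ₗ[ℂ] V) - LinearMap.id) = H := by
      simp only [Finset.mem_filter, not_and]
      rintro - h
      refine (isCoatom_of_mem_hyperplanes hH).1 (h ▸ eq_top_iff.2 fun x _ => ?_)
      exact mem_ker_sub_id.2 rfl
    rw [fixatorOrder, ← Finset.card_insert_of_notMem hnotin, ← Set.ncard_coe_finset]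
    congr 1
    ext w
    simp only [Set.mem_ofPred_eq, Finset.coe_insert, Finset.coe_filter, Set.Finite.mem_toFinset,
      Set.mem_insert_iff]
    constructor
    · rintro ⟨hw, h⟩
      exact (eq_one_or_of_fixes hw hH h).imp id fun h => ⟨⟨hw, h.1⟩, h.2⟩
    · rintro (rfl | ⟨⟨hw, -⟩, rfl⟩)
      · exact ⟨one_mem W, fun _ _ => rfl⟩
      · exact ⟨hw, fun v hv => mem_ker_sub_id.1 hv⟩
  · intro s hs
    simp only [Set.Finite.coe_toFinset, Set.mem_ofPred_eq] at hs ⊢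
    exact ⟨s, hs.1, hs.2, rfl⟩

variable {l : Submodule ℂ V → Dual ℂ V}

theorem discriminantFunction_apply [Finite W] (v : V) : discriminantFunction W l v =
    ∏ H ∈ (hyperplanes_finite (W := W)).toFinset, l H v ^ fixatorOrder W H := by
  rw [discriminantFunction, finprod_mem_eq_finite_toFinset_prod _ hyperplanes_finite,
    Finset.prod_apply]
  rfl

theorem discriminantFunction_mem_homogeneousFunctions [Finite W] :
    discriminantFunction W l ∈ homogeneousFunctions V (numReflections W + numHyperplanes W) := by
  rw [discriminantFunction, finprod_mem_eq_finite_toFinset_prod _ hyperplanes_finite,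
    ← sum_fixatorOrder]
  exact prod_mem_homogeneousFunctions _ fun H _ =>
    Submodule.pow_mem_pow _ (linearForm_mem_linearForms (l H)) _

theorem discriminantFunction_ne_zero_iff [Finite W] (hl : IsChoiceOfForms W l) {v : V} :
    discriminantFunction W l v ≠ 0 ↔ v ∈ regularVectors W := by
  rw [discriminantFunction_apply, Finset.prod_ne_zero_iff]
  refine forall_congr' fun H => ?_
  rw [Set.Finite.mem_toFinset]
  refine imp_congr_right fun hH => ?_
  rw [pow_ne_zero_iff (fixatorOrder_pos H).ne', ne_eq, ← LinearMap.mem_ker, hl H hH]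

theorem exists_mul_of_ker_le {m m' : Dual ℂ V} (h : LinearMap.ker m ≤ LinearMap.ker m') :
    ∃ c : ℂ, ∀ v, m' v = c * m v := by
  by_cases hm : m = 0
  · refine ⟨0, fun v => ?_⟩
    have : v ∈ LinearMap.ker m' := h (by simp [hm])
    simpa using this
  obtain ⟨x, hx⟩ : ∃ x, m x ≠ 0 := by
    by_contra! h
    exact hm (LinearMap.ext h)
  refine ⟨m' x / m x, fun v => ?_⟩
  have : v - (m v / m x) • x ∈ LinearMap.ker m' := h (by simp [hx])
  rw [LinearMap.mem_ker, map_sub, map_smul, smul_eq_mul, sub_eq_zero] at this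
  rw [this]
  ring

theorem pow_fixatorOrder_eq_one {s : V ≃ₗ[ℂ] V} (hs : s ∈ W) {H : Submodule ℂ V}
    (h : ∀ v ∈ H, s v = v) : s ^ fixatorOrder W H = 1 := by
  let K : Subgroup (V ≃ₗ[ℂ] V) :=
    { carrier := {w | w ∈ W ∧ ∀ v ∈ H, w v = v}
      mul_mem' := fun ha hb => ⟨mul_mem ha.1 hb.1, fun v hv => by
        rw [LinearEquiv.mul_apply, hb.2 v hv, ha.2 v hv]⟩
      one_mem' := ⟨one_mem W, fun _ _ => rfl⟩
      inv_mem' := fun {a} ha => ⟨inv_mem ha.1, fun v hv => by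
        change a.symm v = v
        rw [LinearEquiv.symm_apply_eq, ha.2 v hv]⟩ }
  have : (⟨s, hs, h⟩ : K) ^ Nat.card K = 1 := pow_card_eq_one'
  exact congrArg K.subtype this

/-- The reflection permutes the hyperplanes, so it changes the forms only by scalars. The scalar at
its own hyperplane H₀ has trivial e_{H₀}-th power. The product `D` over the other hyperplanes is
multiplied by a constant, which is 1, as seen at a point of H₀ outside those hyperplanes: `s` fixes
it and `D` does not vanish there. -/
theorem discriminantFunction_reflection [Finite W] (hl : IsChoiceOfForms W l) {s : V ≃ₗ[ℂ] V}
    (hs : s ∈ W) (hrefl : IsReflection s) (v : V) :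
    discriminantFunction W l (s v) = discriminantFunction W l v := by
  classical
  set H₀ := LinearMap.ker ((s : V →ₗ[ℂ] V) - LinearMap.id) with hH₀
  have hfix : ∀ v ∈ H₀, s v = v := fun v hv => mem_ker_sub_id.1 hv
  have hH₀mem : H₀ ∈ hyperplanes W := ⟨s, hs, hrefl, rfl⟩
  set A := (hyperplanes_finite (W := W)).toFinset with hA
  have hAmem {H} : H ∈ A ↔ H ∈ hyperplanes W := Set.Finite.mem_toFinset _
  -- the linear forms are permuted up to scalars
  have hform : ∀ H ∈ hyperplanes W, ∃ c : ℂ, ∀ v, l H (s v) = c * l (H.comap s.toLinearMap) v := by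
    intro H hH
    refine exists_mul_of_ker_le (m' := l H ∘ₗ s.toLinearMap) ?_
    rw [hl _ (comap_mem_hyperplanes hs hH), LinearMap.ker_comp, hl H hH]
  choose! c hc using hform
  have hcomap₀ : H₀.comap s.toLinearMap = H₀ := by
    ext x
    rw [Submodule.mem_comap, LinearEquiv.coe_coe, hH₀, mem_ker_sub_id, mem_ker_sub_id,
      s.injective.eq_iff]
  have hc₀ : c H₀ ^ fixatorOrder W H₀ = 1 := by
    have hiter (n : ℕ) (v : V) : l H₀ ((s ^ n) v) = c H₀ ^ n * l H₀ v := by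
      induction n generalizing v with
      | zero => simp
      | succ n ih =>
        rw [pow_succ, LinearEquiv.mul_apply, ih, hc H₀ hH₀mem, hcomap₀]
        ring
    obtain ⟨x, hx⟩ : ∃ x, l H₀ x ≠ 0 := by
      by_contra! h
      refine (isCoatom_of_mem_hyperplanes hH₀mem).1 ?_
      rw [← hl H₀ hH₀mem, eq_top_iff]
      exact fun x _ => h x
    have := hiter (fixatorOrder W H₀) x
    rw [pow_fixatorOrder_eq_one hs hfix] at this
    exact mul_right_cancel₀ hx (by rw [← this, one_mul]; rfl)
  set D : V → ℂ := fun v => ∏ H ∈ A.erase H₀, l H v ^ fixatorOrder W H with hD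
  have hdecomp (v : V) :
      discriminantFunction W l v = l H₀ v ^ fixatorOrder W H₀ * D v := by
    rw [discriminantFunction_apply]
    exact (Finset.mul_prod_erase A (fun H => l H v ^ fixatorOrder W H) (hAmem.2 hH₀mem)).symm
  have hDs (v : V) : D (s v) = (∏ H ∈ A.erase H₀, c H ^ fixatorOrder W H) * D v := by
    have h1 : D (s v) = ∏ H ∈ A.erase H₀, c H ^ fixatorOrder W H *
        l (H.comap s.toLinearMap) v ^ fixatorOrder W (H.comap s.toLinearMap) := by
      refine Finset.prod_congr rfl fun H hH => ?_
      rw [hc H (hAmem.1 (Finset.mem_of_mem_erase hH)), mul_pow, fixatorOrder_comap hs]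
    rw [h1, Finset.prod_mul_distrib]
    congr 1
    have hinj : Function.Injective fun H : Submodule ℂ V => H.comap s.toLinearMap :=
      Submodule.comap_injective_of_surjective s.surjective
    have hmaps : ∀ H ∈ A.erase H₀, H.comap s.toLinearMap ∈ A.erase H₀ := fun H hH => by
      rw [Finset.mem_erase] at hH ⊢
      refine ⟨fun h => hH.1 (hinj (h.trans hcomap₀.symm)), ?_⟩
      exact hAmem.2 (comap_mem_hyperplanes hs (hAmem.1 hH.2))
    refine Finset.prod_bij (fun H _ => H.comap s.toLinearMap) hmaps
      (fun _ _ _ _ h => hinj h) (fun H hH => ?_) fun _ _ => rfl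
    obtain ⟨H', hH', h⟩ := Finset.surj_on_of_inj_on_of_card_le
      (fun H _ => H.comap s.toLinearMap) hmaps (fun _ _ _ _ h => hinj h) le_rfl H hH
    exact ⟨H', hH', h.symm⟩
  obtain ⟨u, huH₀, huD⟩ : ∃ u ∈ H₀, D u ≠ 0 := by
    have := Subspace.biUnion_ne_univ_of_top_notMem
      (s := (A.erase H₀).image fun H => H.comap H₀.subtype) fun h => by
        obtain ⟨H, hH, htop⟩ := Finset.mem_image.1 h
        rw [Submodule.comap_subtype_eq_top] at htop
        rw [Finset.mem_erase] at hH
        rcases hrefl.2.le_iff.1 htop with h | h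
        · exact (isCoatom_of_mem_hyperplanes (hAmem.1 hH.2)).1 h
        · exact hH.1 h
    obtain ⟨u, hu⟩ := (Set.ne_univ_iff_exists_notMem _).1 this
    refine ⟨u, u.2, Finset.prod_ne_zero_iff.2 fun H hH => pow_ne_zero _ fun h => hu ?_⟩
    refine Set.mem_biUnion (Finset.mem_coe.2 (Finset.mem_image_of_mem _ hH)) ?_
    rw [← LinearMap.mem_ker, hl H (hAmem.1 (Finset.mem_of_mem_erase hH))] at h
    exact h
  have hC : ∏ H ∈ A.erase H₀, c H ^ fixatorOrder W H = 1 := by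
    have := hDs u
    rw [hfix u huH₀] at this
    exact mul_right_cancel₀ huD (by rw [← this, one_mul])
  rw [hdecomp, hdecomp, hDs, hC, one_mul, hc H₀ hH₀mem, hcomap₀, mul_pow, hc₀, one_mul]

theorem discriminantFunction_mem_invariants [Finite W]
    (hgen : Subgroup.closure {s : V ≃ₗ[ℂ] V | s ∈ W ∧ IsReflection s} = W)
    (hl : IsChoiceOfForms W l) : discriminantFunction W l ∈ invariants W := by
  refine ⟨homogeneousFunctions_le _ discriminantFunction_mem_homogeneousFunctions,
    fun w hw => ?_⟩
  rw [← hgen] at hw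
  induction hw using Subgroup.closure_induction with
  | mem s hs => exact discriminantFunction_reflection hl hs.1 hs.2
  | one => exact fun v => rfl
  | mul a b _ _ ha hb => exact fun v => by rw [LinearEquiv.mul_apply, ha, hb]
  | inv a _ ha =>
    intro v
    rw [← ha (a⁻¹ v)]
    exact congrArg _ (a.apply_symm_apply v)

end DiscriminantFunction

/-! ### Weighted homogeneous polynomials and monicity -/

section Monic

open MvPolynomial

theorem coeff_aeval_C_mul_X {σ : Type*} [Fintype σ] (c : σ → ℂ) (P : MvPolynomial σ ℂ)
    (m : σ →₀ ℕ) :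
    coeff m (aeval (fun i => C (c i) * X i : σ → MvPolynomial σ ℂ) P) =
      (m.prod fun i k => c i ^ k) * coeff m P := by
  classical
  induction P using MvPolynomial.induction_on' with
  | monomial u a =>
    have : aeval (fun i => C (c i) * X i : σ → MvPolynomial σ ℂ) (monomial u a) =
        monomial u ((u.prod fun i k => c i ^ k) * a) := by
      rw [aeval_monomial, monomial_eq, algebraMap_eq]
      simp only [mul_pow, Finsupp.prod, Finset.prod_mul_distrib, C_mul, map_prod, C_pow]
      ring
    rw [this, coeff_monomial, coeff_monomial]
    split_ifs with h
    · rw [h]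
    · rw [mul_zero]
  | add p q hp hq => rw [map_add, coeff_add, coeff_add, hp, hq]; ring

theorem aeval_pi_apply {σ : Type*} {X : Type*} (f : σ → X → ℂ) (P : MvPolynomial σ ℂ) (x : X) :
    aeval f P x = aeval (fun i => f i x) P := by
  have : (Pi.evalAlgHom ℂ (fun _ : X => ℂ) x).comp (aeval f) = aeval fun i => f i x := by
    ext i
    simp
  exact DFunLike.congr_fun this P

variable {r : ℕ} {d : Fin r → ℕ} {P : MvPolynomial (Fin r) ℂ} {n : ℕ} {i : Fin r}

theorem coeff_coeff_asPolynomialIn (P : MvPolynomial (Fin r) ℂ) (i : Fin r) (k : ℕ)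
    (m : {j : Fin r // j ≠ i} →₀ ℕ) :
    coeff m ((asPolynomialIn i P).coeff k) =
      coeff (Finsupp.single i k + m.mapDomain Subtype.val) P := by
  have h1 := optionEquivLeft_coeff_some_coeff_none ℂ {j : Fin r // j ≠ i} (m.optionElim k)
    (rename (Equiv.optionSubtypeNe i).symm P)
  simp only [Finsupp.some_optionElim, Finsupp.optionElim_apply_none] at h1
  have h2 : m.optionElim k = (Finsupp.single i k + m.mapDomain Subtype.val).mapDomain
      (Equiv.optionSubtypeNe i).symm := by
    rw [Finsupp.mapDomain_add, Finsupp.mapDomain_single, ← Finsupp.mapDomain_comp,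
      Equiv.optionSubtypeNe_symm_self]
    have : (Equiv.optionSubtypeNe i).symm ∘ Subtype.val = (some : {j : Fin r // j ≠ i} → _) := by
      ext j
      simp [j.2]
    rw [this]
    ext (_ | j)
    · simp [Finsupp.mapDomain_of_notMem_range]
    · simp [Finsupp.mapDomain_apply (Option.some_injective _)]
  rw [asPolynomialIn, h1, h2, coeff_rename_mapDomain _ (Equiv.injective _)]

theorem weight_single_add_mapDomain (k : ℕ) (m : {j : Fin r // j ≠ i} →₀ ℕ) :
    Finsupp.weight d (Finsupp.single i k + m.mapDomain Subtype.val) =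
      k * d i + Finsupp.weight d (m.mapDomain Subtype.val) := by
  rw [map_add, Finsupp.weight_single, smul_eq_mul]

theorem IsMonicIn.coeff_ne_zero (h : IsMonicIn i P) :
    coeff (Finsupp.single i (asPolynomialIn i P).natDegree) P ≠ 0 := by
  obtain ⟨c, hc, h⟩ := h
  have := coeff_coeff_asPolynomialIn P i (asPolynomialIn i P).natDegree 0
  rw [Polynomial.coeff_natDegree, h, coeff_zero_C, Finsupp.mapDomain_zero, add_zero] at this
  rwa [← this]

theorem mul_eq_of_coeff_single_ne_zero (hP : P.IsWeightedHomogeneous d n) {k : ℕ}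
    (h : coeff (Finsupp.single i k) P ≠ 0) : k * d i = n := by
  have := hP h
  rwa [Finsupp.weight_single, smul_eq_mul] at this

/-- The power X_i^k already carries the whole weight `n`. As all weights are positive, no other
monomial can have X_i-exponent at least `k`. -/
theorem isMonicIn_of_coeff_ne_zero (hd : ∀ j, 0 < d j) (hP : P.IsWeightedHomogeneous d n) {k : ℕ}
    (h : coeff (Finsupp.single i k) P ≠ 0) : IsMonicIn i P := by
  have hk := mul_eq_of_coeff_single_ne_zero hP h
  have hcoeff : ∀ k' m, k ≤ k' → coeff m ((asPolynomialIn i P).coeff k') ≠ 0 →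
      k' = k ∧ m = 0 := by
    intro k' m hkk' hm
    rw [coeff_coeff_asPolynomialIn] at hm
    have hw := hP hm
    rw [weight_single_add_mapDomain, ← hk] at hw
    have hmul := Nat.mul_le_mul_right (d i) hkk'
    refine ⟨Nat.eq_of_mul_eq_mul_right (hd i) (by omega), ?_⟩
    by_contra hm0
    obtain ⟨j, hj⟩ := Finsupp.ne_iff.1 hm0
    have : (m.mapDomain Subtype.val) j.1 ≠ 0 := by
      rwa [Finsupp.mapDomain_apply Subtype.val_injective]
    have := Finsupp.le_weight_of_ne_zero' d this
    have := hd j.1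
    omega
  have hC : (asPolynomialIn i P).coeff k = C (coeff (Finsupp.single i k) P) := by
    ext m
    by_cases hm : m = 0
    · rw [hm, coeff_coeff_asPolynomialIn, coeff_zero_C, Finsupp.mapDomain_zero, add_zero]
    · rw [coeff_C, if_neg (Ne.symm hm)]
      by_contra hne
      exact hm (hcoeff k m le_rfl hne).2
  have hdeg : (asPolynomialIn i P).natDegree = k := by
    refine le_antisymm (Polynomial.natDegree_le_iff_coeff_eq_zero.2 fun k' hk' => ?_)
      (Polynomial.le_natDegree_of_ne_zero ?_)
    · ext m
      by_contra hne
      exact hk'.ne' (hcoeff k' m hk'.le hne).1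
    · rw [hC]
      simpa using h
  exact ⟨_, h, by rw [Polynomial.leadingCoeff, hdeg, hC]⟩

/-- On the X_i-axis every monomial other than a pure power of X_i vanishes. -/
theorem exists_coeff_single_ne_zero {t : ℂ} (h : aeval (Pi.single i t : Fin r → ℂ) P ≠ 0) :
    ∃ k, coeff (Finsupp.single i k) P ≠ 0 := by
  rw [aeval_def, eval₂_eq] at h
  obtain ⟨m, hm, hne⟩ := Finset.exists_ne_zero_of_sum_ne_zero h
  refine ⟨m i, ?_⟩
  have : m = Finsupp.single i (m i) := by
    ext j
    by_cases hj : j = i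
    · rw [hj, Finsupp.single_eq_same]
    · rw [Finsupp.single_eq_of_ne hj]
      by_contra hmj
      refine (mul_ne_zero_iff.1 hne).2 (Finset.prod_eq_zero (Finsupp.mem_support_iff.2 hmj) ?_)
      rw [Pi.single_eq_of_ne hj, zero_pow hmj]
  rw [← this]
  exact mem_support_iff.1 hm

theorem aeval_single_of_isWeightedHomogeneous (hd : 0 < d i) (hP : P.IsWeightedHomogeneous d n)
    {k : ℕ} (hk : k * d i = n) (t : ℂ) :
    aeval (Pi.single i t : Fin r → ℂ) P = coeff (Finsupp.single i k) P * t ^ k := by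
  rw [aeval_def, eval₂_eq, Finset.sum_eq_single (Finsupp.single i k)]
  · by_cases hk0 : k = 0
    · simp [hk0]
    · rw [Finsupp.support_single _ hk0]
      simp
  · intro m hm hne
    have hw := hP (mem_support_iff.1 hm)
    by_cases hmi : ∃ j, j ≠ i ∧ m j ≠ 0
    · obtain ⟨j, hj, hmj⟩ := hmi
      rw [Finset.prod_eq_zero (Finsupp.mem_support_iff.2 hmj), mul_zero]
      rw [Pi.single_eq_of_ne hj, zero_pow hmj]
    · push Not at hmi
      refine absurd ?_ hne
      have hm' : m = Finsupp.single i (m i) := by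
        ext j
        by_cases hj : j = i
        · rw [hj, Finsupp.single_eq_same]
        · rw [Finsupp.single_eq_of_ne hj, hmi j hj]
      rw [hm', Finsupp.weight_single, smul_eq_mul, ← hk] at hw
      rw [hm', Nat.eq_of_mul_eq_mul_right hd hw]
  · intro h
    rw [notMem_support_iff.1 h]
    simp

end Monic

/-! ### Degrees of a basic system -/

namespace IsBasicSystemWithDegrees

open MvPolynomial

variable {W : Subgroup (V ≃ₗ[ℂ] V)} {f g : Fin (finrank ℂ V) → V → ℂ}
  {d e : Fin (finrank ℂ V) → ℕ}

/-- Replacing v by 2v multiplies the function by 2^n and each X_i by 2^{d_i}. By algebraic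
independence the resulting identity holds between polynomials, and powers of 2 determine their
exponents. -/
theorem isWeightedHomogeneous (hf : IsBasicSystemWithDegrees W d f)
    {P : MvPolynomial (Fin (finrank ℂ V)) ℂ} {n : ℕ}
    (hP : aeval f P ∈ homogeneousFunctions V n) : P.IsWeightedHomogeneous d n := by
  have key : aeval (fun i => C (2 ^ d i) * X i : _ → MvPolynomial (Fin (finrank ℂ V)) ℂ) P =
      C (2 ^ n) * P := by
    refine hf.algebraicIndependent (funext fun v => ?_)
    have h1 := homogeneousFunctions_smul hP 2 v
    rw [map_mul, Pi.mul_apply, aeval_pi_apply f (C _)]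
    simp only [algHom_C, Algebra.algebraMap_self, RingHom.id_apply]
    rw [← h1, aeval_pi_apply, aeval_pi_apply, ← AlgHom.comp_apply]
    congr 1
    ext i
    simp [homogeneousFunctions_smul (hf.homogeneous i)]
  intro m hm
  have h2 := congrArg (coeff m) key
  rw [coeff_aeval_C_mul_X, coeff_C_mul] at h2
  have h3 := mul_right_cancel₀ hm h2
  have h4 : (m.prod fun i k => ((2 : ℂ) ^ d i) ^ k) = 2 ^ Finsupp.weight d m := by
    simp only [Finsupp.prod, ← pow_mul, Finset.prod_pow_eq_pow_sum, Finsupp.weight_apply,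
      Finsupp.sum, smul_eq_mul]
    simp only [mul_comm]
  rw [h4] at h3
  have h5 : (2 : ℕ) ^ Finsupp.weight d m = 2 ^ n := by exact_mod_cast h3
  exact Nat.pow_right_injective le_rfl h5

theorem degree_pos (hf : IsBasicSystemWithDegrees W d f) (i) : 0 < d i := by
  rw [Nat.pos_iff_ne_zero]
  intro h
  have hi := hf.homogeneous i
  rw [h, homogeneousFunctions, pow_zero, Submodule.mem_one] at hi
  obtain ⟨a, ha⟩ := hi
  have : (X i : MvPolynomial (Fin (finrank ℂ V)) ℂ) = C a :=
    hf.algebraicIndependent (by rw [aeval_X, ← ha, algHom_C])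
  have := congrArg totalDegree this
  simp at this

/-- If d_k < e_k, the f_i with i ≤ k have degree below e_k, so they are polynomials in the g_j with
j < k. There are more of them than of these g_j, against the bound by transcendence degree. -/
theorem degree_le (hf : IsBasicSystemWithDegrees W d f) (hg : IsBasicSystemWithDegrees W e g)
    (k : Fin (finrank ℂ V)) : e k ≤ d k := by
  by_contra! hlt
  choose P hP using fun i => hg.exists_aeval_eq (hf.mem_invariants i)
  have hvars (i : {i // i ≤ k}) :
      ((P i.1).vars : Set (Fin (finrank ℂ V))) ⊆ Set.range (Subtype.val : {j // j < k} → _) := by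
    intro j hj
    suffices h : j < k from ⟨⟨j, h⟩, rfl⟩
    obtain ⟨m, hm, hmj⟩ := (mem_vars_iff_mem_support j).1 hj
    have hw := hg.isWeightedHomogeneous (P := P i.1) (n := d i.1)
      (by rw [hP]; exact hf.homogeneous _) (mem_support_iff.1 hm)
    have h1 := Finsupp.le_weight_of_ne_zero' e (Finsupp.mem_support_iff.1 hmj)
    have h2 := hf.sorted i.2
    by_contra hjk
    have h3 := hg.sorted (not_lt.1 hjk)
    omega
  choose Q hQ using fun i : {i // i ≤ k} =>
    exists_rename_eq_of_vars_subset_range (P i.1) _ Subtype.val_injective (hvars i)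
  have hind : AlgebraicIndependent ℂ Q := by
    refine AlgebraicIndependent.of_comp ((aeval g).comp (rename Subtype.val)) ?_
    have : ((aeval g).comp (rename Subtype.val)) ∘ Q = f ∘ (Subtype.val : {i // i ≤ k} → _) := by
      ext1 i
      rw [Function.comp_apply, AlgHom.comp_apply, hQ, hP, Function.comp_apply]
    rw [this]
    exact hf.algebraicIndependent.comp _ Subtype.val_injective
  have hcard := hind.cardinalMk_le_trdeg
  rw [MvPolynomial.trdeg_of_isDomain, Cardinal.lift_id, Cardinal.mk_fintype, Cardinal.mk_fintype,
    Nat.cast_le] at hcard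
  rw [Fintype.card_subtype, Fintype.card_subtype] at hcard
  refine absurd (Finset.card_lt_card (Finset.ssubset_iff_of_subset ?_ |>.2 ⟨k, ?_⟩)) hcard.not_gt
  · exact fun x hx => by simpa using (Finset.mem_filter.1 hx).2.le
  · simp

theorem degrees_eq (hf : IsBasicSystemWithDegrees W d f) : degrees W = d := by
  have h : ∃ d, ∃ f, IsBasicSystemWithDegrees W d f := ⟨d, f, hf⟩
  rw [degrees, dif_pos h]
  obtain ⟨g, hg⟩ := h.choose_spec
  exact funext fun k => le_antisymm (hf.degree_le hg k) (hg.degree_le hf k)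

variable {l : Submodule ℂ V → Dual ℂ V}

theorem aeval_discriminant [Finite W] (hf : IsBasicSystemWithDegrees W d f)
    (hgen : Subgroup.closure {s : V ≃ₗ[ℂ] V | s ∈ W ∧ IsReflection s} = W)
    (hl : IsChoiceOfForms W l) : aeval f (discriminant W l f) = discriminantFunction W l :=
  Function.invFun_eq (hf.exists_aeval_eq (discriminantFunction_mem_invariants hgen hl))

theorem discriminant_isWeightedHomogeneous [Finite W] (hf : IsBasicSystemWithDegrees W d f)
    (hgen : Subgroup.closure {s : V ≃ₗ[ℂ] V | s ∈ W ∧ IsReflection s} = W)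
    (hl : IsChoiceOfForms W l) :
    (discriminant W l f).IsWeightedHomogeneous d (numReflections W + numHyperplanes W) :=
  hf.isWeightedHomogeneous (by
    rw [hf.aeval_discriminant hgen hl]
    exact discriminantFunction_mem_homogeneousFunctions)

end IsBasicSystemWithDegrees

/-! ### Regular numbers and monic discriminants -/

namespace IsBasicSystemWithDegrees

open MvPolynomial

variable {W : Subgroup (V ≃ₗ[ℂ] V)} {f : Fin (finrank ℂ V) → V → ℂ}
  {d : Fin (finrank ℂ V) → ℕ} {i : Fin (finrank ℂ V)} {l : Submodule ℂ V → Dual ℂ V}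

theorem pow_apply_eq {w : V ≃ₗ[ℂ] V} {ζ : ℂ} {v : V} (h : w v = ζ • v) (n : ℕ) :
    (w ^ n) v = ζ ^ n • v := by
  induction n with
  | zero => simp
  | succ n ih => rw [pow_succ, LinearEquiv.mul_apply, h, map_smul, ih, smul_smul, pow_succ']

/-- If ζ^n = 1 then w^n fixes the regular vector `v`, hence is 1. -/
theorem orderOf_eq [FiniteDimensional ℂ V] [Finite W] (hf : IsBasicSystemWithDegrees W d f)
    {w : V ≃ₗ[ℂ] V} (hw : w ∈ W) {ζ : ℂ} {v : V} (hv : v ∈ regularVectors W) (hv0 : v ≠ 0)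
    (h : w v = ζ • v) : orderOf w = orderOf ζ := by
  rw [orderOf_eq_orderOf_iff]
  intro n
  have hn := pow_apply_eq h n
  constructor
  · intro h1
    rw [h1] at hn
    exact smul_left_injective ℂ hv0 (by simpa using hn.symm)
  · intro h1
    exact hf.eq_one_of_apply_eq hv (pow_mem hw n) (by rw [hn, h1, one_smul])

theorem exists_of_isRegularNumber [FiniteDimensional ℂ V] [Finite W] [Nontrivial V]
    (hf : IsBasicSystemWithDegrees W d f) {n : ℕ} (h : IsRegularNumber W n) :
    ∃ w ∈ W, ∃ ζ : ℂ, orderOf w = n ∧ orderOf ζ = n ∧ ∃ v ∈ regularVectors W, w v = ζ • v := by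
  obtain ⟨w, hw, ⟨ζ, -, v, hv, hwv⟩, hn⟩ := h
  -- The vector 0 counts as regular when there are no hyperplanes, and it says nothing about ζ. Then
  -- w = 1, and any non-zero vector serves with eigenvalue 1.
  by_cases hv0 : v = 0
  · obtain ⟨u, hu⟩ := exists_ne (0 : V)
    have hw1 : w = 1 := hf.eq_one_of_apply_eq hv hw (by rw [hv0, map_zero])
    refine ⟨w, hw, 1, hn, by rw [← hn, hw1, orderOf_one, orderOf_one], u, fun H hH => ?_, ?_⟩
    · exact absurd (hv0 ▸ H.zero_mem) (hv H hH)
    · rw [hw1, one_smul]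
      rfl
  · exact ⟨w, hw, ζ, hn, by rw [← hn, hf.orderOf_eq hw hv hv0 hwv], v, hv, hwv⟩

/-- Springer's argument: f_j(v) = f_j(wv) = ζ^{d_j} f_j(v). -/
theorem apply_eq_zero [Finite W] (hf : IsBasicSystemWithDegrees W d f) {w : V ≃ₗ[ℂ] V}
    (hw : w ∈ W) {ζ : ℂ} {v : V} (h : w v = ζ • v) {j} (hj : ¬ orderOf ζ ∣ d j) : f j v = 0 := by
  have h1 := (hf.mem_invariants j).2 w hw v
  rw [h, homogeneousFunctions_smul (hf.homogeneous j)] at h1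
  by_contra hne
  exact hj (orderOf_dvd_of_pow_eq_one (mul_right_cancel₀ hne (h1.trans (one_mul _).symm)))

theorem aeval_discriminant_apply [Finite W] (hf : IsBasicSystemWithDegrees W d f)
    (hgen : Subgroup.closure {s : V ≃ₗ[ℂ] V | s ∈ W ∧ IsReflection s} = W)
    (hl : IsChoiceOfForms W l) {v : V} {t : ℂ} (hv : ∀ j, f j v = (Pi.single i t : _ → ℂ) j) :
    aeval (Pi.single i t : _ → ℂ) (discriminant W l f) = discriminantFunction W l v := by
  rw [← hf.aeval_discriminant hgen hl, aeval_pi_apply, funext hv]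

theorem isRegularNumber_of_isMonicIn [FiniteDimensional ℂ V] [Finite W]
    (hf : IsBasicSystemWithDegrees W d f)
    (hgen : Subgroup.closure {s : V ≃ₗ[ℂ] V | s ∈ W ∧ IsReflection s} = W)
    (hl : IsChoiceOfForms W l) (h : IsMonicIn i (discriminant W l f)) :
    IsRegularNumber W (d i) := by
  have hwt := hf.discriminant_isWeightedHomogeneous hgen hl
  obtain ⟨v, hv⟩ := hf.exists_apply_eq (Pi.single i 1)
  have hreg : v ∈ regularVectors W := by
    rw [← discriminantFunction_ne_zero_iff hl, ← hf.aeval_discriminant_apply hgen hl hv,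
      aeval_single_of_isWeightedHomogeneous (hf.degree_pos i) hwt
        (mul_eq_of_coeff_single_ne_zero hwt h.coeff_ne_zero), one_pow, mul_one]
    exact h.coeff_ne_zero
  have hv0 : v ≠ 0 := by
    rintro rfl
    have h1 := homogeneousFunctions_smul (hf.homogeneous i) 0 0
    rw [smul_zero, zero_pow (hf.degree_pos i).ne', zero_mul, hv] at h1
    simp at h1
  have hζ := Complex.isPrimitiveRoot_exp (d i) (hf.degree_pos i).ne'
  set ζ := Complex.exp (2 * Real.pi * Complex.I / d i)
  -- Scaling by ζ preserves f_i, because ζ^{d_i} = 1, and the other f_j vanish at `v`; so `v` and ζv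
  -- lie in one orbit.
  obtain ⟨w, hw, hwv⟩ := hf.exists_apply_eq_of_forall_eq (v := v) (v' := ζ • v) fun j => by
    rw [homogeneousFunctions_smul (hf.homogeneous j)]
    by_cases hj : j = i
    · rw [hj, hζ.pow_eq_one, one_mul]
    · rw [hv, Pi.single_eq_of_ne hj, mul_zero]
  refine ⟨w, hw, ⟨ζ, ?_, v, hreg, hwv⟩, ?_⟩
  · exact isOfFinOrder_iff_pow_eq_one.2 ⟨d i, hf.degree_pos i, hζ.pow_eq_one⟩
  · rw [hf.orderOf_eq hw hreg hv0 hwv, hζ.eq_orderOf]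

theorem isMonicIn_of_forall_apply_eq_zero [Finite W] (hf : IsBasicSystemWithDegrees W d f)
    (hgen : Subgroup.closure {s : V ≃ₗ[ℂ] V | s ∈ W ∧ IsReflection s} = W)
    (hl : IsChoiceOfForms W l) {v : V} (hv : v ∈ regularVectors W)
    (h : ∀ j, j ≠ i → f j v = 0) : IsMonicIn i (discriminant W l f) := by
  have h1 : ∀ j, f j v = (Pi.single i (f i v) : _ → ℂ) j := fun j => by
    by_cases hj : j = i
    · rw [hj, Pi.single_eq_same]
    · rw [h j hj, Pi.single_eq_of_ne hj]
  have h2 := (discriminantFunction_ne_zero_iff hl).2 hv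
  rw [← hf.aeval_discriminant_apply hgen hl h1] at h2
  obtain ⟨k, hk⟩ := exists_coeff_single_ne_zero h2
  exact isMonicIn_of_coeff_ne_zero hf.degree_pos
    (hf.discriminant_isWeightedHomogeneous hgen hl) hk

/-- A homogeneous invertible change of variables turns a basic system into a basic system. -/
theorem changeOfVariables (hf : IsBasicSystemWithDegrees W d f)
    {θ η : Fin (finrank ℂ V) → MvPolynomial (Fin (finrank ℂ V)) ℂ}
    (hθη : ∀ j, aeval θ (η j) = X j) (hηθ : ∀ j, aeval η (θ j) = X j)
    (hhom : ∀ j, aeval f (θ j) ∈ homogeneousFunctions V (d j)) :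
    IsBasicSystemWithDegrees W d fun j => aeval f (θ j) := by
  have hcomp : aeval (fun j => aeval f (θ j)) = (aeval f).comp (aeval θ) := by
    ext1 j
    simp
  have h1 : (aeval θ).comp (aeval η) = AlgHom.id ℂ _ := by
    ext1 j
    exact (congrArg _ (aeval_X _ _)).trans (hθη j)
  have h2 : (aeval η).comp (aeval θ) = AlgHom.id ℂ _ := by
    ext1 j
    exact (congrArg _ (aeval_X _ _)).trans (hηθ j)
  have h1' (P) : aeval θ (aeval η P) = P := by rw [← AlgHom.comp_apply, h1, AlgHom.id_apply]
  have h2' (P) : aeval η (aeval θ P) = P := by rw [← AlgHom.comp_apply, h2, AlgHom.id_apply]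
  refine ⟨?_, ?_, hhom, hf.sorted⟩
  · rw [AlgebraicIndependent, hcomp, AlgHom.coe_comp]
    refine Function.Injective.comp hf.algebraicIndependent fun P Q hPQ => ?_
    rw [← h2' P, hPQ, h2']
  · rw [← hf.adjoin_eq, Algebra.adjoin_range_eq_range_aeval, Algebra.adjoin_range_eq_range_aeval,
      hcomp]
    refine le_antisymm ?_ ?_
    · rintro _ ⟨P, rfl⟩
      exact ⟨aeval θ P, rfl⟩
    · rintro _ ⟨P, rfl⟩
      exact ⟨aeval η P, congrArg (aeval f) (h1' P)⟩

theorem exists_forall_apply_eq_zero (hf : IsBasicSystemWithDegrees W d f) {v : V}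
    (hi : f i v ≠ 0) (hv : ∀ j, ¬ d i ∣ d j → f j v = 0) :
    ∃ g, IsBasicSystemWithDegrees W d g ∧ ∀ j, j ≠ i → g j v = 0 := by
  classical
  -- Subtracting c_j f_i^{d_j/d_i} from f_j cancels its value at `v`. Where d_i does not divide d_j
  -- the truncated quotient is harmless, since f_j(v) = 0 gives c_j = 0. As X_i itself is unchanged,
  -- the substitutions for `s` and `-s` are mutually inverse.
  set c : Fin (finrank ℂ V) → ℂ := fun j => if j = i then 0 else f j v / f i v ^ (d j / d i)
    with hc
  have hci : c i = 0 := if_pos rfl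
  let θ (s : ℂ) (j : Fin (finrank ℂ V)) : MvPolynomial (Fin (finrank ℂ V)) ℂ :=
    X j - C (s * c j) * X i ^ (d j / d i)
  have hθi (s : ℂ) : θ s i = X i := by simp [θ, hci]
  have hinv (s s' : ℂ) (hs : s + s' = 0) (j) : aeval (θ s) (θ s' j) = X j := by
    have : aeval (θ s) (θ s' j) = θ s j - C (s' * c j) * θ s i ^ (d j / d i) := by
      simp [θ, algebraMap_eq]
    rw [this, hθi, eq_neg_of_add_eq_zero_left hs]
    simp [θ]
  have happ (j) : aeval f (θ 1 j) = f j - c j • f i ^ (d j / d i) := by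
    ext x
    simp [θ, Algebra.smul_def]
  refine ⟨_, hf.changeOfVariables (θ := θ 1) (η := θ (-1)) (hinv _ _ (by norm_num))
    (hinv _ _ (by norm_num)) fun j => ?_, fun j hj => ?_⟩
  · rw [happ]
    refine sub_mem (hf.homogeneous j) ?_
    by_cases hcj : c j = 0
    · rw [hcj, zero_smul]
      exact zero_mem _
    · have hdvd : d i ∣ d j := by
        by_contra h
        refine hcj ?_
        rw [hc]
        simp [hv j h]
      refine Submodule.smul_mem _ _ ?_
      have := Submodule.pow_mem_pow _ (hf.homogeneous i) (d j / d i)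
      rwa [homogeneousFunctions, ← pow_mul, Nat.mul_div_cancel' hdvd] at this
  · change aeval f (θ 1 j) v = 0
    rw [happ]
    have : f i v ^ (d j / d i) ≠ 0 := pow_ne_zero _ hi
    simp [hc, hj, this]

/-- If the order of `ζ` is the degree of `f i`, then `f i` does not vanish identically on the
regular vectors of an eigenspace of an element of `W` with eigenvalue `ζ`, if there are any. -/
theorem exists_regular_apply_ne_zero [FiniteDimensional ℂ V] [Finite W]
    (hf : IsBasicSystemWithDegrees W d f)
    (hl : IsChoiceOfForms W l) {w : V ≃ₗ[ℂ] V} (hw : w ∈ W) {ζ : ℂ} (horder : orderOf w = d i)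
    (hζ : orderOf ζ = d i) {v : V} (hv : v ∈ regularVectors W) (hwv : w v = ζ • v) :
    ∃ u ∈ regularVectors W, w u = ζ • u ∧ f i u ≠ 0 := by
  by_cases hfv : f i v = 0
  swap
  · exact ⟨v, hv, hwv, hfv⟩
  have hζd : ζ ^ d i = 1 := hζ ▸ pow_orderOf_eq_one ζ
  have hζ0 : ζ ≠ 0 := by
    rintro rfl
    rw [zero_pow (hf.degree_pos i).ne'] at hζd
    exact zero_ne_one hζd
  set m := differential (f i) v with hm
  -- f_i is unchanged both by `w` and by multiplication by ζ; differentiating the two identities at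
  -- `v` compares both with the differential at wv = ζv.
  have hmζ (x : V) : m (w x) = ζ * m x := by
    have h1 := differential_comp (hf.mem_polynomialFunctions i) w.toLinearMap v
    have h2 := differential_comp (hf.mem_polynomialFunctions i) (ζ • LinearMap.id) v
    have e1 : (fun y => f i (w.toLinearMap y)) = f i :=
      funext fun y => (hf.mem_invariants i).2 w hw y
    have e2 : (fun y => f i ((ζ • LinearMap.id : V →ₗ[ℂ] V) y)) = f i := funext fun y => by
      rw [LinearMap.smul_apply, LinearMap.id_apply, homogeneousFunctions_smul (hf.homogeneous i),
        hζd, one_mul]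
    rw [e1, LinearEquiv.coe_coe, hwv] at h1
    rw [e2, LinearMap.smul_apply, LinearMap.id_apply] at h2
    have h1x := LinearMap.congr_fun h1 x
    have h2x := LinearMap.congr_fun h2 (w x)
    simp only [LinearMap.comp_apply, LinearEquiv.coe_coe, LinearMap.smul_apply,
      LinearMap.id_apply, map_smul, smul_eq_mul] at h1x h2x
    rw [hm, h2x, h1x]
  obtain ⟨y, hy⟩ : ∃ y, m y ≠ 0 := by
    by_contra! h
    refine hf.jacobian_ne_zero hv (Matrix.det_eq_zero_of_row_eq_zero i fun j => ?_)
    exact h _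
  -- Up to the factor d_i, the projection of `y` to the ζ-eigenspace of `w`; all its terms take the
  -- same value under `m`.
  set x := ∑ k ∈ Finset.range (d i), (ζ⁻¹ ^ k) • (w ^ k) y with hx
  have hmx : m x = d i * m y := by
    have hpow (k : ℕ) : m ((w ^ k) y) = ζ ^ k * m y := by
      induction k with
      | zero => simp
      | succ k ih => rw [pow_succ', LinearEquiv.mul_apply, hmζ, ih, pow_succ']; ring
    rw [hx, map_sum]
    have hterm (k : ℕ) : m ((ζ⁻¹ ^ k) • (w ^ k) y) = m y := by
      rw [map_smul, hpow, smul_eq_mul, ← mul_assoc, ← mul_pow, inv_mul_cancel₀ hζ0, one_pow,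
        one_mul]
    rw [Finset.sum_congr rfl fun k _ => hterm k]
    simp
  have hwx : w x = ζ • x := by
    have hterm (k : ℕ) : w ((ζ⁻¹ ^ k) • (w ^ k) y) = ζ • ((ζ⁻¹ ^ (k + 1)) • (w ^ (k + 1)) y) := by
      rw [map_smul, pow_succ' w, LinearEquiv.mul_apply, smul_smul, pow_succ', ← mul_assoc,
        mul_inv_cancel₀ hζ0, one_mul]
    rw [hx, map_sum, Finset.sum_congr rfl fun k _ => hterm k, ← Finset.smul_sum]
    congr 1
    -- Applying `w` shifts the index by one. The terms k = 0 and k = d_i agree, because w and ζ both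
    -- have d_i-th power 1, so the shifted sum is the original one.
    have := (Finset.sum_range_succ (fun k => (ζ⁻¹ ^ k) • (w ^ k) y) (d i)).symm.trans
      (Finset.sum_range_succ' _ _)
    rw [inv_pow, hζd, ← horder, pow_orderOf_eq_one] at this
    rw [← horder]
    simpa using this.symm
  have hmx0 : m x ≠ 0 := by
    rw [hmx]
    exact mul_ne_zero (Nat.cast_ne_zero.2 (hf.degree_pos i).ne') hy
  -- Along v + t x the derivative of f_i at t = 0 is m x ≠ 0, so f_i is non-zero for small t ≠ 0; by
  -- continuity the discriminant stays non-zero too.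
  have hder := hasLineDerivAt_differential (hf.mem_polynomialFunctions i) v x
  have hev1 := HasDerivAt.eventually_ne hder hmx0 (c := 0)
  have hD := hasLineDerivAt_differential
    (homogeneousFunctions_le _ (discriminantFunction_mem_homogeneousFunctions (W := W) (l := l))) v x
  have hev2 := (HasDerivAt.continuousAt hD).eventually_ne (y := 0) (by
    rw [zero_smul, add_zero]
    exact (discriminantFunction_ne_zero_iff hl).2 hv)
  obtain ⟨t, ht1, ht2⟩ := (hev1.and (hev2.filter_mono nhdsWithin_le_nhds)).exists
  exact ⟨v + t • x, (discriminantFunction_ne_zero_iff hl).1 ht2, by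
    rw [map_add, map_smul, hwv, hwx, smul_add, smul_comm], ht1⟩

theorem exists_isMonicIn_of_isRegularNumber [FiniteDimensional ℂ V] [Finite W]
    (hf : IsBasicSystemWithDegrees W d f)
    (hgen : Subgroup.closure {s : V ≃ₗ[ℂ] V | s ∈ W ∧ IsReflection s} = W)
    (hl : IsChoiceOfForms W l) (h : IsRegularNumber W (d i)) :
    ∃ g, IsSystemOfBasicInvariants W g ∧ IsMonicIn i (discriminant W l g) := by
  have : Nontrivial V := Module.nontrivial_of_finrank_pos (R := ℂ) i.pos
  obtain ⟨w, hw, ζ, hwd, hζd, v, hv, hwv⟩ := hf.exists_of_isRegularNumber h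
  obtain ⟨u, hu, hwu, hfu⟩ := hf.exists_regular_apply_ne_zero hl hw hwd hζd hv hwv
  obtain ⟨g, hg, hgu⟩ := hf.exists_forall_apply_eq_zero hfu fun j hj =>
    hf.apply_eq_zero hw hwu (hζd ▸ hj)
  exact ⟨g, ⟨d, hg⟩, hg.isMonicIn_of_forall_apply_eq_zero hgen hl hu hgu⟩

theorem isMonicIn_of_isRegularNumber [FiniteDimensional ℂ V] [Finite W]
    (hf : IsBasicSystemWithDegrees W d f)
    (hgen : Subgroup.closure {s : V ≃ₗ[ℂ] V | s ∈ W ∧ IsReflection s} = W)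
    (hl : IsChoiceOfForms W l) (h : IsRegularNumber W (d i)) (hi : ∀ j, d i ∣ d j → j = i) :
    IsMonicIn i (discriminant W l f) := by
  have : Nontrivial V := Module.nontrivial_of_finrank_pos (R := ℂ) i.pos
  obtain ⟨w, hw, ζ, -, hζd, v, hv, hwv⟩ := hf.exists_of_isRegularNumber h
  exact hf.isMonicIn_of_forall_apply_eq_zero hgen hl hv fun j hj =>
    hf.apply_eq_zero hw hwv (hζd ▸ fun hdvd => hj (hi j hdvd))

end IsBasicSystemWithDegrees

/-! ### Finite groups generated by pseudo-reflections acting on a polynomial ring -/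

section Chevalley

open MvPolynomial

attribute [local instance] MvPolynomial.gradedAlgebra

variable {σ : Type*}

theorem exists_minimal_generators {S ι : Type*} [CommRing S] [DecidableEq ι] (h : ι → S)
    (s : Finset ι) : ∃ K ⊆ s, Ideal.span (h '' K) = Ideal.span (h '' s) ∧
      ∀ k ∈ K, h k ∉ Ideal.span (h '' (K.erase k)) := by
  induction s using Finset.strongInduction with
  | H s ih =>
    by_cases hs : ∃ k ∈ s, h k ∈ Ideal.span (h '' (s.erase k))
    · obtain ⟨k, hk, hmem⟩ := hs
      obtain ⟨K, hK, hspan, hmin⟩ := ih _ (Finset.erase_ssubset hk)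
      refine ⟨K, hK.trans (Finset.erase_subset _ _), hspan.trans (le_antisymm ?_ ?_), hmin⟩
      · exact Ideal.span_mono (Set.image_mono (by simp))
      · rw [Ideal.span_le]
        rintro _ ⟨j, hj, rfl⟩
        by_cases hjk : j = k
        · rw [hjk]
          exact hmem
        · exact Ideal.subset_span ⟨j, Finset.mem_coe.2 (Finset.mem_erase.2 ⟨hjk, hj⟩), rfl⟩
    · push Not at hs
      exact ⟨s, subset_rfl, rfl, hs⟩

theorem homogeneousComponent_mul_of_isHomogeneous (a : MvPolynomial σ ℂ) {x : MvPolynomial σ ℂ}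
    {e : ℕ} (hx : x.IsHomogeneous e) (n : ℕ) :
    homogeneousComponent n (a * x) =
      if e ≤ n then homogeneousComponent (n - e) a * x else 0 := by
  have key (p : MvPolynomial σ ℂ) (m : ℕ) :
      (DirectSum.decompose (homogeneousSubmodule σ ℂ) p m : MvPolynomial σ ℂ) =
        homogeneousComponent m p := decomposition.decompose'_apply p m
  have := DirectSum.coe_decompose_mul_of_right_mem (homogeneousSubmodule σ ℂ) n (a := a)
    ((mem_homogeneousSubmodule e x).2 hx)
  rwa [key, key] at this

/-- A graded form of Nakayama's lemma: the component of degree `e` of a x is a(0) x. -/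
theorem mem_of_mul_mem {J : Ideal (MvPolynomial σ ℂ)}
    (hJ : J.IsHomogeneous (homogeneousSubmodule σ ℂ)) {a x : MvPolynomial σ ℂ} {e : ℕ}
    (hx : x.IsHomogeneous e) (ha : constantCoeff a ≠ 0) (h : a * x ∈ J) : x ∈ J := by
  have h1 := homogeneousComponent_mem_of_mem hJ h e
  rw [homogeneousComponent_mul_of_isHomogeneous a hx, if_pos le_rfl, Nat.sub_self,
    homogeneousComponent_zero] at h1
  have h2 := J.mul_mem_left (C (coeff 0 a)⁻¹) h1
  rwa [← mul_assoc, ← C_mul, inv_mul_cancel₀ (by simpa [constantCoeff_eq] using ha), C_1,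
    one_mul] at h2

theorem span_image_isHomogeneous {ι : Type*} {f : ι → MvPolynomial σ ℂ} {d : ι → ℕ}
    (hf : ∀ i, (f i).IsHomogeneous (d i)) (s : Set ι) :
    (Ideal.span (f '' s)).IsHomogeneous (homogeneousSubmodule σ ℂ) :=
  Ideal.homogeneous_span _ _ (by rintro _ ⟨i, -, rfl⟩; exact ⟨d i, hf i⟩)

theorem aeval_isHomogeneous {ι : Type*} {f : ι → MvPolynomial σ ℂ} {d : ι → ℕ}
    (hf : ∀ i, (f i).IsHomogeneous (d i)) {P : MvPolynomial ι ℂ} {n : ℕ}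
    (hP : P.IsWeightedHomogeneous d n) : (aeval f P).IsHomogeneous n := by
  rw [aeval_def, eval₂_eq]
  refine IsHomogeneous.sum _ _ _ fun m hm => ?_
  rw [algebraMap_eq]
  refine IsHomogeneous.C_mul ?_ _
  rw [← hP (mem_support_iff.1 hm), Finsupp.weight_apply]
  refine IsHomogeneous.prod _ _ _ fun i _ => ?_
  simpa [mul_comm] using (hf i).pow (m i)

theorem pderiv_aeval {ι : Type*} [Fintype ι] (f : ι → MvPolynomial σ ℂ) (P : MvPolynomial ι ℂ)
    (k : σ) :
    pderiv k (aeval f P) = ∑ i, aeval f (pderiv i P) * pderiv k (f i) := by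
  classical
  induction P using MvPolynomial.induction_on with
  | C a => simp [algebraMap_eq]
  | add p q hp hq => simp only [map_add, hp, hq, add_mul, Finset.sum_add_distrib]
  | mul_X p j hp =>
    simp only [map_mul, aeval_X, Derivation.leibniz, hp, smul_eq_mul, pderiv_X, map_add, add_mul,
      Finset.sum_add_distrib, Finset.mul_sum]
    congr 1
    · rw [Finset.sum_eq_single j]
      · simp
      · intro i _ hij
        simp [Pi.single_eq_of_ne' hij]
      · simp
    · exact Finset.sum_congr rfl fun i _ => by ring

/-- If a relation `P(f) = 0` exists between homogeneous elements of positive degrees, there are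
homogeneous elements `h i`, not all zero, with `∑ h i * ∂ (f i) = 0` for all partial derivatives. -/
theorem exists_relation_of_not_algebraicIndependent {ι : Type*} [Fintype ι]
    {f : ι → MvPolynomial σ ℂ} {d : ι → ℕ} (hd : ∀ i, 0 < d i)
    (hf : ∀ i, (f i).IsHomogeneous (d i)) (hind : ¬ AlgebraicIndependent ℂ f) :
    ∃ Q : ι → MvPolynomial ι ℂ, ∃ e : ι → ℕ, (∀ i, (aeval f (Q i)).IsHomogeneous (e i)) ∧
      (∃ i, aeval f (Q i) ≠ 0) ∧ ∀ k, ∑ i, aeval f (Q i) * pderiv k (f i) = 0 := by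
  classical
  rw [algebraicIndependent_iff] at hind
  push Not at hind
  obtain ⟨P₀, hP₀, hP₀0⟩ := hind
  -- The weighted components of a relation are again relations, as their values at `f` lie in
  -- different degrees.
  have hex : ∃ n, ∃ P : MvPolynomial ι ℂ, P.IsWeightedHomogeneous d n ∧ P ≠ 0 ∧ aeval f P = 0 := by
    by_contra! hcon
    refine hP₀0 ?_
    rw [← sum_weightedHomogeneousComponent d P₀]
    refine finsum_eq_zero_of_forall_eq_zero fun n => ?_
    by_contra hn
    refine hcon n _ (weightedHomogeneousComponent_isWeightedHomogeneous n P₀) hn ?_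
    have h1 : ∀ n, (aeval f (weightedHomogeneousComponent d n P₀)).IsHomogeneous n :=
      fun n => aeval_isHomogeneous hf (weightedHomogeneousComponent_isWeightedHomogeneous n P₀)
    have h2 := congrArg (fun P => homogeneousComponent n (aeval f P))
      (sum_weightedHomogeneousComponent d P₀)
    simp only [hP₀, map_zero] at h2
    have hfin : (Function.support fun m => weightedHomogeneousComponent d m P₀).Finite :=
      weightedHomogeneousComponent_finsupp P₀
    rw [finsum_eq_sum_of_support_subset (s := hfin.toFinset) _ (by simp), map_sum, map_sum,
      Finset.sum_congr rfl fun m _ => homogeneousComponent_of_mem (h1 m), Finset.sum_ite_eq] at h2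
    rwa [if_pos (hfin.mem_toFinset.2 hn)] at h2
  -- Take the least possible weight: a non-zero ∂_i P has smaller weight, so it cannot vanish at
  -- `f`, and Euler's formula shows that some ∂_i P is non-zero. The chain rule applied to P(f) = 0
  -- gives the relation.
  obtain ⟨P, hP, hP0, hPf⟩ := Nat.find_spec hex
  set n := Nat.find hex with hn
  have hn0 : n ≠ 0 := by
    intro h0
    rw [h0] at hP
    have hC : P = C (coeff 0 P) := by
      ext m
      rw [coeff_C]
      split_ifs with hm
      · rw [hm]
      · by_contra hne
        obtain ⟨i, hi⟩ := Finsupp.ne_iff.1 (Ne.symm hm)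
        have h1 := Finsupp.le_weight_of_ne_zero' d hi
        have h2 := hP hne
        have h3 := hd i
        omega
    rw [hC, algHom_C, algebraMap_eq, C_eq_zero] at hPf
    rw [hPf, C_0] at hC
    exact hP0 hC
  have hle (i : ι) (hi : pderiv i P ≠ 0) : d i ≤ n := by
    have : i ∈ P.vars := by
      by_contra h
      exact hi (pderiv_eq_zero_of_notMem_vars h)
    obtain ⟨m, hm, hmi⟩ := (mem_vars_iff_mem_support i).1 this
    rw [← hP (mem_support_iff.1 hm)]
    exact Finsupp.le_weight_of_ne_zero' d (Finsupp.mem_support_iff.1 hmi)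
  have hwt (i : ι) : (pderiv i P).IsWeightedHomogeneous d (n - d i) := by
    by_cases hi : pderiv i P = 0
    · rw [hi]
      exact isWeightedHomogeneous_zero _ _ _
    · exact hP.pderiv (Nat.sub_add_cancel (hle i hi))
  refine ⟨fun i => pderiv i P, fun i => n - d i, fun i => aeval_isHomogeneous hf (hwt i), ?_,
    fun k => by rw [← pderiv_aeval, hPf, map_zero]⟩
  obtain ⟨i, hi⟩ : ∃ i, pderiv i P ≠ 0 := by
    by_contra! h
    have := hP.sum_weight_X_mul_pderiv
    simp only [h, mul_zero, smul_zero, Finset.sum_const_zero] at this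
    rcases smul_eq_zero.1 this.symm with h | h
    · exact hn0 h
    · exact hP0 h
  refine ⟨i, fun h => ?_⟩
  have h1 : n - d i < n := Nat.sub_lt (Nat.pos_of_ne_zero hn0) (hd i)
  exact Nat.find_min hex h1 ⟨_, hwt i, hi, h⟩

end Chevalley

/-! ### The Hilbert ideal and Chevalley's lemma -/

section Chevalley

open MvPolynomial

attribute [local instance] MvPolynomial.gradedAlgebra

variable {σ G : Type*} [Group G]

/-- The algebra of the polynomials fixed by a group of automorphisms. -/
def fixedPolynomials (ρ : G →* (MvPolynomial σ ℂ →ₐ[ℂ] MvPolynomial σ ℂ)) :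
    Subalgebra ℂ (MvPolynomial σ ℂ) where
  carrier := {p | ∀ g, ρ g p = p}
  mul_mem' := fun ha hb g => by rw [map_mul, ha, hb]
  add_mem' := fun ha hb g => by rw [map_add, ha, hb]
  algebraMap_mem' := fun c g => (ρ g).commutes c

/-- The ideal generated by the homogeneous invariants of positive degree. -/
def hilbertIdeal (ρ : G →* (MvPolynomial σ ℂ →ₐ[ℂ] MvPolynomial σ ℂ)) :
    Ideal (MvPolynomial σ ℂ) :=
  Ideal.span {p | p ∈ fixedPolynomials ρ ∧ ∃ n, 0 < n ∧ p.IsHomogeneous n}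

variable {ρ : G →* (MvPolynomial σ ℂ →ₐ[ℂ] MvPolynomial σ ℂ)}

theorem mem_fixedPolynomials {p : MvPolynomial σ ℂ} :
    p ∈ fixedPolynomials ρ ↔ ∀ g, ρ g p = p :=
  Iff.rfl

section Average

variable [Fintype G]

theorem sum_mem_fixedPolynomials (p : MvPolynomial σ ℂ) :
    ∑ g, ρ g p ∈ fixedPolynomials ρ := by
  intro h
  rw [map_sum, ← Equiv.sum_comp (Equiv.mulLeft h) fun g => ρ g p]
  refine Finset.sum_congr rfl fun g _ => ?_
  rw [Equiv.coe_mulLeft, map_mul, AlgHom.mul_apply]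

theorem sum_mul_of_mem_fixedPolynomials {x : MvPolynomial σ ℂ} (hx : x ∈ fixedPolynomials ρ)
    (p : MvPolynomial σ ℂ) : ∑ g, ρ g (x * p) = x * ∑ g, ρ g p := by
  rw [Finset.mul_sum]
  exact Finset.sum_congr rfl fun g _ => by rw [map_mul, hx g]

end Average

theorem homogeneousComponent_map
    (hρ : ∀ g n (p : MvPolynomial σ ℂ), p.IsHomogeneous n → (ρ g p).IsHomogeneous n)
    (g : G) (n : ℕ) (p : MvPolynomial σ ℂ) :
    homogeneousComponent n (ρ g p) = ρ g (homogeneousComponent n p) := by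
  conv_lhs => rw [← sum_homogeneousComponent p, map_sum, map_sum]
  rw [Finset.sum_congr rfl fun m _ => homogeneousComponent_of_mem
    ((mem_homogeneousSubmodule m _).2 (hρ g m _ (homogeneousComponent_isHomogeneous m p))),
    Finset.sum_ite_eq]
  split_ifs with h
  · rfl
  · rw [homogeneousComponent_eq_zero _ _ (by simpa using h), map_zero]

theorem homogeneousComponent_mem_fixedPolynomials
    (hρ : ∀ g n (p : MvPolynomial σ ℂ), p.IsHomogeneous n → (ρ g p).IsHomogeneous n)
    {p : MvPolynomial σ ℂ}
    (hp : p ∈ fixedPolynomials ρ) (n : ℕ) : homogeneousComponent n p ∈ fixedPolynomials ρ :=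
  fun g => by rw [← homogeneousComponent_map hρ, hp]

theorem totalDegree_map_le
    (hρ : ∀ g n (p : MvPolynomial σ ℂ), p.IsHomogeneous n → (ρ g p).IsHomogeneous n)
    (g : G) (p : MvPolynomial σ ℂ) :
    (ρ g p).totalDegree ≤ p.totalDegree := by
  conv_lhs => rw [← sum_homogeneousComponent p, map_sum]
  refine totalDegree_finsetSum_le fun m hm => ?_
  have := (hρ g m _ (homogeneousComponent_isHomogeneous m p)).totalDegree_le
  have := Finset.mem_range.1 hm
  omega

theorem mem_hilbertIdeal_of_constantCoeff_eq_zero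
    (hρ : ∀ g n (p : MvPolynomial σ ℂ), p.IsHomogeneous n → (ρ g p).IsHomogeneous n)
    {p : MvPolynomial σ ℂ}
    (hp : p ∈ fixedPolynomials ρ) (h0 : constantCoeff p = 0) : p ∈ hilbertIdeal ρ := by
  rw [← sum_homogeneousComponent p]
  refine sum_mem fun n _ => ?_
  rcases Nat.eq_zero_or_pos n with rfl | hn
  · rw [homogeneousComponent_zero, ← constantCoeff_eq, h0, C_0]
    exact zero_mem _
  · exact Ideal.subset_span ⟨homogeneousComponent_mem_fixedPolynomials hρ hp n, n, hn,
      homogeneousComponent_isHomogeneous n p⟩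

theorem map_mem_hilbertIdeal (g : G) {p : MvPolynomial σ ℂ} (hp : p ∈ hilbertIdeal ρ) :
    ρ g p ∈ hilbertIdeal ρ := by
  have h : hilbertIdeal ρ ≤ (hilbertIdeal ρ).comap (ρ g) := Ideal.span_le.2 fun q hq => by
    change ρ g q ∈ hilbertIdeal ρ
    rw [hq.1 g]
    exact Ideal.subset_span hq
  exact h hp

/-- The map g ↦ ρ g p - p is a cocycle and the ideal is stable, so the generators of the group
suffice. -/
theorem map_sub_self_mem_hilbertIdeal {T : Set G} (hT : Subgroup.closure T = ⊤)
    {p : MvPolynomial σ ℂ} (h : ∀ t ∈ T, ρ t p - p ∈ hilbertIdeal ρ) (g : G) :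
    ρ g p - p ∈ hilbertIdeal ρ := by
  have hg : g ∈ Subgroup.closure T := hT ▸ Subgroup.mem_top g
  induction hg using Subgroup.closure_induction with
  | mem t ht => exact h t ht
  | one => simp
  | mul a b _ _ ha hb =>
    have : ρ (a * b) p - p = ρ a (ρ b p - p) + (ρ a p - p) := by
      rw [map_mul, map_sub, AlgHom.mul_apply]
      ring
    rw [this]
    exact add_mem (map_mem_hilbertIdeal a hb) ha
  | inv a _ ha =>
    have h1 : ρ a⁻¹ (ρ a p) = p := by
      rw [← AlgHom.mul_apply, ← map_mul, inv_mul_cancel, map_one, AlgHom.one_apply]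
    have : ρ a⁻¹ p - p = - ρ a⁻¹ (ρ a p - p) := by
      rw [map_sub, h1]
      ring
    rw [this]
    exact neg_mem (map_mem_hilbertIdeal _ ha)

/-- Chevalley's lemma: if `∑ x i * u i = 0` with homogeneous invariants `x i`, and `x k` is not in
the ideal generated by the other `x i`, then `u k` is in the Hilbert ideal. -/
theorem mem_hilbertIdeal_of_sum_mul_eq_zero [Finite G]
    (hρ : ∀ g n (p : MvPolynomial σ ℂ), p.IsHomogeneous n → (ρ g p).IsHomogeneous n)
    {T : Set G} (hT : Subgroup.closure T = ⊤)
    (hrefl : ∀ t ∈ T, ∃ l : MvPolynomial σ ℂ, l.IsHomogeneous 1 ∧ l ≠ 0 ∧ ∀ p, l ∣ ρ t p - p)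
    {ι : Type*} [DecidableEq ι] {x : ι → MvPolynomial σ ℂ} {e : ι → ℕ} {K : Finset ι}
    (hx : ∀ i, x i ∈ fixedPolynomials ρ) (hxe : ∀ i, (x i).IsHomogeneous (e i)) {k : ι}
    (hk : k ∈ K) (hmin : x k ∉ Ideal.span (x '' (K.erase k))) {u : ι → MvPolynomial σ ℂ}
    (hu : ∑ i ∈ K, x i * u i = 0) : u k ∈ hilbertIdeal ρ := by
  have := Fintype.ofFinite G
  induction hn : (u k).totalDegree using Nat.strong_induction_on generalizing u with
  | _ n ih =>
  -- Writing ρ t (u i) - u i = l * v i, the quotients satisfy the same relation because the x_i are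
  -- invariant. Unless zero, `v k` has smaller degree than `u k`, so induction applies.
  have hdiff : ∀ t ∈ T, ρ t (u k) - u k ∈ hilbertIdeal ρ := by
    intro t ht
    obtain ⟨l, hl1, hl0, hl⟩ := hrefl t ht
    choose v hv using fun i => hl (u i)
    have hsum : ∑ i ∈ K, x i * v i = 0 := by
      refine (mul_eq_zero.1 (?_ : l * _ = 0)).resolve_left hl0
      have h1 : ∑ i ∈ K, x i * ρ t (u i) = 0 := by
        have := congrArg (ρ t) hu
        rw [map_sum, map_zero] at this
        rw [← this]
        exact Finset.sum_congr rfl fun i _ => by rw [map_mul, hx i t]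
      rw [Finset.mul_sum, ← sub_zero (0 : MvPolynomial σ ℂ)]
      nth_rewrite 1 [← h1]
      rw [← hu, ← Finset.sum_sub_distrib]
      exact Finset.sum_congr rfl fun i _ => by rw [← mul_sub, hv]; ring
    rw [hv k]
    refine Ideal.mul_mem_left _ _ ?_
    by_cases hvk : v k = 0
    · rw [hvk]
      exact zero_mem _
    refine ih _ ?_ hsum rfl
    have h1 : (l * v k).totalDegree = 1 + (v k).totalDegree := by
      rw [totalDegree_mul_of_isDomain hl0 hvk, hl1.totalDegree hl0]
    have h2 : (ρ t (u k) - u k).totalDegree ≤ n :=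
      (totalDegree_sub _ _).trans (max_le ((totalDegree_map_le hρ t _).trans hn.le) hn.le)
    rw [hv k, h1] at h2
    omega
  have hall := map_sub_self_mem_hilbertIdeal hT hdiff
  have havg : (∑ g, ρ g (u k)) - C (Fintype.card G : ℂ) * u k ∈ hilbertIdeal ρ := by
    have : (∑ g, ρ g (u k)) - C (Fintype.card G : ℂ) * u k = ∑ g, (ρ g (u k) - u k) := by
      simp
    rw [this]
    exact sum_mem fun g _ => hall g
  -- Averaging the relation makes its coefficients invariant. If the average of `u k` had a non-zero
  -- constant term, `x k` would lie in the ideal of the other x_i.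
  have havg_mem : ∑ g, ρ g (u k) ∈ hilbertIdeal ρ := by
    refine mem_hilbertIdeal_of_constantCoeff_eq_zero hρ (sum_mem_fixedPolynomials _) ?_
    by_contra h0
    refine hmin (mem_of_mul_mem (span_image_isHomogeneous hxe _) (hxe k) h0 ?_)
    have h1 : ∑ i ∈ K, x i * ∑ g, ρ g (u i) = 0 := by
      have h2 : ∑ g, ρ g (∑ i ∈ K, x i * u i) = 0 := by simp [hu]
      rw [← h2]
      simp only [map_sum]
      rw [Finset.sum_comm]
      exact Finset.sum_congr rfl fun i _ => (sum_mul_of_mem_fixedPolynomials (hx i) _).symm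
    rw [← Finset.add_sum_erase K _ hk] at h1
    rw [mul_comm, eq_neg_of_add_eq_zero_left h1]
    exact neg_mem (sum_mem fun i hi => Ideal.mul_mem_right _ _
      (Ideal.subset_span ⟨i, Finset.mem_coe.2 hi, rfl⟩))
  have h1 := Ideal.mul_mem_left _ (C (Fintype.card G : ℂ)⁻¹) (sub_mem havg_mem havg)
  rwa [sub_sub_cancel, ← mul_assoc, ← C_mul,
    inv_mul_cancel₀ (Nat.cast_ne_zero.2 Fintype.card_ne_zero), C_1, one_mul] at h1

end Chevalley

/-! ### Generation, independence and number of the basic invariants -/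

section Chevalley

open MvPolynomial

attribute [local instance] MvPolynomial.gradedAlgebra

variable {σ G : Type*} [Group G] {ρ : G →* (MvPolynomial σ ℂ →ₐ[ℂ] MvPolynomial σ ℂ)}

/-- Hilbert's argument: write an invariant of degree n > 0 as a combination of the generators of the
ideal, average the coefficients and keep degree n. The new coefficients are invariants of degree
below n. -/
theorem adjoin_eq_fixedPolynomials [Finite G]
    (hρ : ∀ g n (p : MvPolynomial σ ℂ), p.IsHomogeneous n → (ρ g p).IsHomogeneous n)
    {F : Finset (MvPolynomial σ ℂ)} {d : F → ℕ} (hF : ∀ x : F, x.1 ∈ fixedPolynomials ρ)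
    (hd : ∀ x : F, 0 < d x) (hhom : ∀ x : F, x.1.IsHomogeneous (d x))
    (hspan : Ideal.span (F : Set (MvPolynomial σ ℂ)) = hilbertIdeal ρ) :
    Algebra.adjoin ℂ (F : Set (MvPolynomial σ ℂ)) = fixedPolynomials ρ := by
  have := Fintype.ofFinite G
  refine le_antisymm (Algebra.adjoin_le fun x hx => hF ⟨x, hx⟩) fun p hp => ?_
  suffices h : ∀ n, ∀ p ∈ fixedPolynomials ρ, p.IsHomogeneous n →
      p ∈ Algebra.adjoin ℂ (F : Set (MvPolynomial σ ℂ)) by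
    rw [← sum_homogeneousComponent p]
    exact sum_mem fun n _ => h n _ (homogeneousComponent_mem_fixedPolynomials hρ hp n)
      (homogeneousComponent_isHomogeneous n p)
  intro n
  induction n using Nat.strong_induction_on with
  | _ n ih =>
  intro p hp hpn
  rcases Nat.eq_zero_or_pos n with rfl | hn
  · rw [← totalDegree_zero_iff_isHomogeneous, totalDegree_eq_zero_iff_eq_C] at hpn
    rw [hpn]
    exact Subalgebra.algebraMap_mem _ _
  have hmem : p ∈ Ideal.span (Set.range fun x : F => x.1) := by
    have : Set.range (fun x : F => x.1) = (F : Set (MvPolynomial σ ℂ)) := by simp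
    rw [this, hspan]
    exact Ideal.subset_span ⟨hp, n, hn, hpn⟩
  obtain ⟨a, ha⟩ := Ideal.mem_span_range_iff_exists_fun.1 hmem
  have h1 : C (Fintype.card G : ℂ) * p = ∑ x : F, (∑ g, ρ g (a x)) * x.1 := by
    have h2 : ∑ g, ρ g p = C (Fintype.card G : ℂ) * p := by
      simp [mem_fixedPolynomials.1 hp]
    rw [← h2]
    conv_lhs => rw [← ha]
    simp only [map_sum]
    rw [Finset.sum_comm]
    refine Finset.sum_congr rfl fun x _ => ?_
    rw [mul_comm (a x), sum_mul_of_mem_fixedPolynomials (hF x), mul_comm]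
  have h3 : C (Fintype.card G : ℂ) * p =
      ∑ x : F, homogeneousComponent n ((∑ g, ρ g (a x)) * x.1) := by
    rw [← map_sum, ← h1, homogeneousComponent_C_mul, homogeneousComponent_eq_self hpn]
  have h4 : p = C (Fintype.card G : ℂ)⁻¹ * (C (Fintype.card G : ℂ) * p) := by
    rw [← mul_assoc, ← C_mul, inv_mul_cancel₀ (Nat.cast_ne_zero.2 Fintype.card_ne_zero), C_1,
      one_mul]
  rw [h4, h3]
  refine mul_mem (Subalgebra.algebraMap_mem _ _) (sum_mem fun x _ => ?_)
  rw [homogeneousComponent_mul_of_isHomogeneous _ (hhom x)]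
  split_ifs with hle
  · refine mul_mem (ih _ (Nat.sub_lt hn (hd x)) _ ?_ (homogeneousComponent_isHomogeneous _ _))
      (Algebra.subset_adjoin x.2)
    exact homogeneousComponent_mem_fixedPolynomials hρ (sum_mem_fixedPolynomials _) _
  · exact zero_mem _

/-- Chevalley's argument: an algebraic dependence gives ∑ h_i ∂_k f_i = 0 with homogeneous
invariants h_i. Expressing all h_i by a minimal generating subset `K` of their ideal yields
relations ∑ h_i u_{k,i} = 0 over `K`, to which Chevalley's lemma applies. Euler's identity then
contradicts the minimality of the f_i. -/
theorem algebraicIndependent_of_minimal [Fintype σ] [Finite G]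
    (hρ : ∀ g n (p : MvPolynomial σ ℂ), p.IsHomogeneous n → (ρ g p).IsHomogeneous n)
    {T : Set G} (hT : Subgroup.closure T = ⊤)
    (hrefl : ∀ t ∈ T, ∃ l : MvPolynomial σ ℂ, l.IsHomogeneous 1 ∧ l ≠ 0 ∧ ∀ p, l ∣ ρ t p - p)
    {ι : Type*} [Fintype ι] [DecidableEq ι] {f : ι → MvPolynomial σ ℂ} {d : ι → ℕ}
    (hf : ∀ i, f i ∈ fixedPolynomials ρ) (hd : ∀ i, 0 < d i)
    (hhom : ∀ i, (f i).IsHomogeneous (d i))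
    (hspan : Ideal.span (Set.range f) = hilbertIdeal ρ)
    (hmin : ∀ i, f i ∉ Ideal.span (f '' {i}ᶜ)) : AlgebraicIndependent ℂ f := by
  by_contra hind
  obtain ⟨Q, e, hQe, ⟨i₁, hi₁⟩, hrel⟩ := exists_relation_of_not_algebraicIndependent hd hhom hind
  set h : ι → MvPolynomial σ ℂ := fun i => aeval f (Q i) with hh
  have hhR (i) : h i ∈ fixedPolynomials ρ := by
    have : Algebra.adjoin ℂ (Set.range f) ≤ fixedPolynomials ρ :=
      Algebra.adjoin_le (by rintro _ ⟨i, rfl⟩; exact hf i)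
    rw [Algebra.adjoin_range_eq_range_aeval] at this
    exact this ⟨Q i, rfl⟩
  obtain ⟨K, -, hK, hKmin⟩ := exists_minimal_generators h Finset.univ
  obtain ⟨k₀, hk₀⟩ : K.Nonempty := by
    rw [Finset.nonempty_iff_ne_empty]
    rintro rfl
    have h1 : h i₁ ∈ Ideal.span (h '' (Finset.univ : Finset ι)) :=
      Ideal.subset_span ⟨i₁, by simp, rfl⟩
    rw [← hK] at h1
    have h2 : h i₁ = 0 := by simpa using h1
    exact hi₁ h2
  have hcoef (j : ι) : ∃ c : ι → MvPolynomial σ ℂ, h j = ∑ i ∈ K, c i * h i ∧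
      (j ∈ K → ∀ i, c i = if i = j then 1 else 0) := by
    by_cases hj : j ∈ K
    · exact ⟨fun i => if i = j then 1 else 0, by simp [hj], fun _ _ => rfl⟩
    · have h1 : h j ∈ Ideal.span (h '' K) := by
        rw [hK]
        exact Ideal.subset_span ⟨j, by simp, rfl⟩
      obtain ⟨c, hc⟩ := Submodule.mem_span_image_finset_iff_exists_fun' _ |>.1 h1
      exact ⟨c, by simpa using hc.symm, fun h => absurd h hj⟩
  choose c hc hcK using hcoef
  set u : σ → ι → MvPolynomial σ ℂ := fun k i => ∑ j, c j i * pderiv k (f j) with hu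
  have husum (k : σ) : ∑ i ∈ K, h i * u k i = 0 := by
    have h1 : ∑ j, (∑ i ∈ K, c j i * h i) * pderiv k (f j) = 0 := by
      rw [← hrel k]
      exact Finset.sum_congr rfl fun j _ => by rw [← hc j]
    rw [← h1]
    simp only [hu, Finset.mul_sum, Finset.sum_mul]
    rw [Finset.sum_comm]
    exact Finset.sum_congr rfl fun j _ => Finset.sum_congr rfl fun i _ => by ring
  have humem (k : σ) : u k k₀ ∈ Ideal.span (Set.range f) := by
    rw [hspan]
    exact mem_hilbertIdeal_of_sum_mul_eq_zero hρ hT hrefl hhR hQe hk₀ (hKmin k₀ hk₀) (husum k)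
  choose a ha using fun k => Ideal.mem_span_range_iff_exists_fun.1 (humem k)
  -- Euler's identity
  have heuler : ∑ j, c j k₀ * (d j • f j) = ∑ j, (∑ k, X k * a k j) * f j := by
    have h1 (j : ι) : d j • f j = ∑ k, X k * pderiv k (f j) := (hhom j).sum_X_mul_pderiv.symm
    have h2 (k : σ) : ∑ j, c j k₀ * pderiv k (f j) = ∑ j, a k j * f j := (ha k).symm
    simp only [h1, Finset.mul_sum, Finset.sum_mul]
    rw [Finset.sum_comm]
    conv_rhs => rw [Finset.sum_comm]
    refine Finset.sum_congr rfl fun k _ => ?_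
    have h3 := congrArg (X k * ·) (h2 k)
    simp only [Finset.mul_sum] at h3
    refine Eq.trans (Finset.sum_congr rfl fun j _ => ?_)
      (h3.trans (Finset.sum_congr rfl fun j _ => ?_)) <;> ring
  -- The coefficient of f_{k₀} in Euler's identity has constant term d_{k₀} ≠ 0, since the terms X_k
  -- a_{k,k₀} have none.
  refine hmin k₀ (mem_of_mul_mem (a := C (d k₀ : ℂ) - ∑ k, X k * a k k₀)
    (span_image_isHomogeneous hhom _) (hhom k₀) ?_ ?_)
  · simpa using (hd k₀).ne'
  · have hmem (b : ι → MvPolynomial σ ℂ) :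
        ∑ j ∈ Finset.univ.erase k₀, b j * f j ∈ Ideal.span (f '' {k₀}ᶜ) :=
      sum_mem fun j hj => Ideal.mul_mem_left _ _
        (Ideal.subset_span ⟨j, by simpa using hj, rfl⟩)
    rw [← Finset.add_sum_erase _ _ (Finset.mem_univ k₀),
      ← Finset.add_sum_erase _ _ (Finset.mem_univ k₀), hcK k₀ hk₀, if_pos rfl, one_mul] at heuler
    have h4 : (C (d k₀ : ℂ) - ∑ k, X k * a k k₀) * f k₀ =
        ∑ j ∈ Finset.univ.erase k₀, (∑ k, X k * a k j) * f j -
          ∑ j ∈ Finset.univ.erase k₀, (c j k₀ * C (d j : ℂ)) * f j := by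
      have h5 : ∑ j ∈ Finset.univ.erase k₀, c j k₀ * (d j • f j) =
          ∑ j ∈ Finset.univ.erase k₀, (c j k₀ * C (d j : ℂ)) * f j :=
        Finset.sum_congr rfl fun j _ => by rw [nsmul_eq_mul, mul_assoc, map_natCast]
      rw [← h5, sub_mul, map_natCast, ← nsmul_eq_mul]
      linear_combination heuler
    rw [h4]
    exact sub_mem (hmem _) (hmem _)

theorem isAlgebraic_fixedPolynomials [Finite G] :
    Algebra.IsAlgebraic (fixedPolynomials ρ) (MvPolynomial σ ℂ) := by
  let action : MulSemiringAction G (MvPolynomial σ ℂ) :=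
    { smul := fun g p => ρ g p
      one_smul := fun p => by change ρ 1 p = p; simp
      mul_smul := fun g h p => by change ρ (g * h) p = ρ g (ρ h p); simp
      smul_zero := fun g => map_zero (ρ g)
      smul_add := fun g => map_add (ρ g)
      smul_one := fun g => map_one (ρ g)
      smul_mul := fun g => map_mul (ρ g) }
  have : Algebra.IsInvariant (fixedPolynomials ρ) (MvPolynomial σ ℂ) G :=
    ⟨fun b hb => ⟨⟨b, hb⟩, rfl⟩⟩
  have : Algebra.IsIntegral (fixedPolynomials ρ) (MvPolynomial σ ℂ) :=
    Algebra.IsInvariant.isIntegral _ _ G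
  infer_instance

/-- The theorem of Shephard-Todd and Chevalley: the invariants of a finite group generated by
reflections form a polynomial algebra. -/
theorem exists_algebraicIndependent_adjoin_eq [Fintype σ] [Finite G]
    (hρ : ∀ g n (p : MvPolynomial σ ℂ), p.IsHomogeneous n → (ρ g p).IsHomogeneous n)
    {T : Set G} (hT : Subgroup.closure T = ⊤)
    (hrefl : ∀ t ∈ T, ∃ l : MvPolynomial σ ℂ, l.IsHomogeneous 1 ∧ l ≠ 0 ∧ ∀ p, l ∣ ρ t p - p) :
    ∃ (f : σ → MvPolynomial σ ℂ) (d : σ → ℕ), AlgebraicIndependent ℂ f ∧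
      Algebra.adjoin ℂ (Set.range f) = fixedPolynomials ρ ∧ ∀ i, (f i).IsHomogeneous (d i) := by
  classical
  obtain ⟨F₀, hF₀, hspan₀⟩ := (Submodule.fg_span_iff_fg_span_finset_subset
    {p | p ∈ fixedPolynomials ρ ∧ ∃ n, 0 < n ∧ p.IsHomogeneous n}).1
      (IsNoetherian.noetherian (R := MvPolynomial σ ℂ) _)
  obtain ⟨F, hFF₀, hspan, hmin⟩ := exists_minimal_generators (id : MvPolynomial σ ℂ → _) F₀
  simp only [Set.image_id] at hspan hmin
  have hFspan : Ideal.span (F : Set (MvPolynomial σ ℂ)) = hilbertIdeal ρ :=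
    hspan.trans hspan₀.symm
  have hF (x : F) := hF₀ (hFF₀ x.2)
  choose hinv d hd hhom using hF
  have hadj := adjoin_eq_fixedPolynomials hρ hinv hd hhom hFspan
  have hrange : Set.range (Subtype.val : F → MvPolynomial σ ℂ) = F := by simp
  have hind : AlgebraicIndependent ℂ (Subtype.val : F → MvPolynomial σ ℂ) := by
    refine algebraicIndependent_of_minimal hρ hT hrefl hinv hd hhom (hrange ▸ hFspan) fun i hi => ?_
    refine hmin i i.2 ?_
    have himage : (F.erase i.1 : Set (MvPolynomial σ ℂ)) = Subtype.val '' {i}ᶜ := by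
      ext x
      rw [Finset.mem_coe, Finset.mem_erase]
      constructor
      · exact fun h => ⟨⟨x, h.2⟩, fun h' => h.1 (congrArg Subtype.val h'), rfl⟩
      · rintro ⟨y, hy, rfl⟩
        exact ⟨fun h => hy (Subtype.ext h), y.2⟩
    rw [himage]
    exact hi
  -- The polynomial ring is algebraic over the invariants, so the generators form a transcendence
  -- basis and are as many as the variables.
  have hbasis : IsTranscendenceBasis ℂ (Subtype.val : F → MvPolynomial σ ℂ) := by
    rw [hind.isTranscendenceBasis_iff_isAlgebraic, hrange, hadj]
    exact isAlgebraic_fixedPolynomials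
  have hcard := hbasis.cardinalMk_eq_trdeg
  rw [MvPolynomial.trdeg_of_isDomain, Cardinal.lift_uzero] at hcard
  obtain ⟨ε⟩ := Cardinal.eq.1 hcard
  refine ⟨Subtype.val ∘ ε.symm, d ∘ ε.symm, hind.comp _ ε.symm.injective, ?_, fun i => hhom _⟩
  rw [ε.symm.surjective.range_comp, hrange, hadj]

end Chevalley

/-! ### Existence of basic systems and the main theorem -/

section Existence

open MvPolynomial

variable [FiniteDimensional ℂ V] {W : Subgroup (V ≃ₗ[ℂ] V)}

/-- The polynomial in coordinates of the composite of a polynomial function with `w⁻¹`. -/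
def translate (w : V ≃ₗ[ℂ] V) :
    MvPolynomial (Fin (finrank ℂ V)) ℂ →ₐ[ℂ] MvPolynomial (Fin (finrank ℂ V)) ℂ :=
  aeval fun i => linearPolynomial ((finBasis ℂ V).coord i ∘ₗ (w⁻¹ : V ≃ₗ[ℂ] V).toLinearMap)

theorem evalCoord_translate (w : V ≃ₗ[ℂ] V) (p : MvPolynomial (Fin (finrank ℂ V)) ℂ) (v : V) :
    evalCoord V (translate w p) v = evalCoord V p ((w⁻¹ : V ≃ₗ[ℂ] V) v) := by
  induction p using MvPolynomial.induction_on with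
  | C a => simp [translate, evalCoord_apply]
  | add p q hp hq => simp only [map_add, Pi.add_apply, hp, hq]
  | mul_X p i hp =>
    simp only [map_mul, Pi.mul_apply, hp]
    congr 1
    rw [translate, aeval_X, evalCoord_linearPolynomial, evalCoord_apply, aeval_X]
    rfl

variable (W) in
/-- The action of `W` on the polynomials in coordinates. -/
def polynomialAction :
    W →* (MvPolynomial (Fin (finrank ℂ V)) ℂ →ₐ[ℂ] MvPolynomial (Fin (finrank ℂ V)) ℂ) where
  toFun w := translate w.1
  map_one' := by
    refine AlgHom.ext fun p => evalCoord_injective (funext fun v => ?_)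
    rw [evalCoord_translate]
    simp
  map_mul' w w' := by
    refine AlgHom.ext fun p => evalCoord_injective (funext fun v => ?_)
    rw [AlgHom.mul_apply, evalCoord_translate, evalCoord_translate, evalCoord_translate,
      Subgroup.coe_mul, mul_inv_rev]
    rfl

theorem evalCoord_mem_invariants_iff {p : MvPolynomial (Fin (finrank ℂ V)) ℂ} :
    evalCoord V p ∈ invariants W ↔ p ∈ fixedPolynomials (polynomialAction W) := by
  constructor
  · intro h w
    refine evalCoord_injective (funext fun v => ?_)
    exact (evalCoord_translate w.1 p v).trans (h.2 _ (inv_mem w.2) v)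
  · refine fun h => ⟨evalCoord_mem p, fun w hw v => ?_⟩
    have h1 := congrFun (congrArg (evalCoord V) (h ⟨w⁻¹, inv_mem hw⟩)) v
    rw [← h1]
    refine Eq.trans ?_ (evalCoord_translate w⁻¹ p v).symm
    rw [inv_inv]

/-- A twisted Leibniz rule reduces to the variables. There the difference is a linear form that
vanishes on ker m, hence a multiple of `m`. -/
theorem linearPolynomial_dvd_translate_sub {s : V ≃ₗ[ℂ] V} {m : Dual ℂ V}
    (hm : ∀ v, m v = 0 → s v = v) (p : MvPolynomial (Fin (finrank ℂ V)) ℂ) :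
    linearPolynomial m ∣ translate s p - p := by
  induction p using MvPolynomial.induction_on with
  | C a => simp [translate]
  | add p q hp hq =>
    have : translate s (p + q) - (p + q) = (translate s p - p) + (translate s q - q) := by
      rw [map_add]; ring
    rw [this]
    exact dvd_add hp hq
  | mul_X p i hp =>
    have : translate s (p * X i) - p * X i =
        translate s p * (translate s (X i) - X i) + (translate s p - p) * X i := by
      rw [map_mul]; ring
    rw [this]
    refine dvd_add (Dvd.dvd.mul_left ?_ _) (Dvd.dvd.mul_right hp _)
    set x := (finBasis ℂ V).coord i
    obtain ⟨c, hc⟩ := exists_mul_of_ker_le (m := m)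
      (m' := x ∘ₗ (s⁻¹ : V ≃ₗ[ℂ] V).toLinearMap - x) fun v hv => by
        have h1 : s.symm v = v := by rw [LinearEquiv.symm_apply_eq, hm v hv]
        change x (s.symm v) - x v = 0
        rw [h1, sub_self]
    refine ⟨C c, evalCoord_injective (funext fun v => ?_)⟩
    rw [map_sub, Pi.sub_apply, evalCoord_translate, map_mul, Pi.mul_apply,
      evalCoord_linearPolynomial, mul_comm]
    simpa [evalCoord_apply, x] using hc v

theorem exists_isBasicSystemWithDegrees [Finite W]
    (hgen : Subgroup.closure {s : V ≃ₗ[ℂ] V | s ∈ W ∧ IsReflection s} = W) :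
    ∃ d f, IsBasicSystemWithDegrees W d f := by
  obtain ⟨f, d, hind, hadj, hhom⟩ := exists_algebraicIndependent_adjoin_eq
    (ρ := polynomialAction W) (T := {s | IsReflection s.1})
    (fun w n p hp => by
      have h := hp.aeval _ fun i => linearPolynomial_isHomogeneous
        ((finBasis ℂ V).coord i ∘ₗ (w.1⁻¹ : V ≃ₗ[ℂ] V).toLinearMap)
      rwa [one_mul] at h)
    (by
      refine Subgroup.map_injective W.subtype_injective ?_
      rw [MonoidHom.map_closure, ← MonoidHom.range_eq_map, Subgroup.range_subtype]
      convert hgen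
      ext s
      simp [and_comm])
    (fun s hs => by
      obtain ⟨m, hm0, hm⟩ := Submodule.exists_le_ker_of_lt_top _ (lt_top_iff_ne_top.2 hs.2.1)
      have hker := (hs.2.le_iff.1 hm).resolve_left fun h => hm0 (LinearMap.ker_eq_top.1 h)
      refine ⟨linearPolynomial m, linearPolynomial_isHomogeneous m, fun h => hm0 ?_,
        linearPolynomial_dvd_translate_sub fun v hv => ?_⟩
      · ext v
        rw [← congrFun (evalCoord_linearPolynomial m) v, h, map_zero]
        rfl
      · rw [← LinearMap.mem_ker, hker] at hv
        exact mem_ker_sub_id.1 hv)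
  -- The degrees have to increase, so the generators are reindexed.
  refine ⟨d ∘ Tuple.sort d, fun i => evalCoord V (f (Tuple.sort d i)), ?_, ?_,
    fun i => evalCoord_mem_homogeneousFunctions (hhom _), Tuple.monotone_sort d⟩
  · exact (hind.map' evalCoord_injective).comp _ (Tuple.sort d).injective
  · have h1 : Set.range (fun i => evalCoord V (f (Tuple.sort d i))) =
        evalCoord V '' Set.range f := by
      rw [← Set.range_comp]
      exact (Tuple.sort d).surjective.range_comp fun i => evalCoord V (f i)
    rw [h1, ← AlgHom.map_adjoin, hadj]
    ext g
    constructor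
    · rintro ⟨p, hp, rfl⟩
      exact evalCoord_mem_invariants_iff.2 hp
    · intro hg
      obtain ⟨p, rfl⟩ := exists_evalCoord_eq hg.1
      exact ⟨p, evalCoord_mem_invariants_iff.1 hg, rfl⟩

end Existence

end ComplexReflection

end

/-! ### The main theorem -/

theorem mainTheorem3 {V : Type*} [AddCommGroup V] [Module ℂ V] [FiniteDimensional ℂ V]
    (W : Subgroup (V ≃ₗ[ℂ] V)) (hW : ComplexReflection.IsIrreducibleReflectionGroup W)
    (l : Submodule ℂ V → Module.Dual ℂ V) (hl : ComplexReflection.IsChoiceOfForms W l)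
    (i₀ : Fin (Module.finrank ℂ V)) :
    ((ComplexReflection.IsRegularNumber W (ComplexReflection.degrees W i₀) ↔
        ∃ f, ComplexReflection.IsSystemOfBasicInvariants W f ∧
          ComplexReflection.IsMonicIn i₀ (ComplexReflection.discriminant W l f)) ∧
      ∀ f, ComplexReflection.IsSystemOfBasicInvariants W f →
        ComplexReflection.IsMonicIn i₀ (ComplexReflection.discriminant W l f) →
        ((ComplexReflection.asPolynomialIn i₀
            (ComplexReflection.discriminant W l f)).natDegree : ℚ) =
          ((ComplexReflection.numReflections W : ℚ) + ComplexReflection.numHyperplanes W) /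
            ComplexReflection.degrees W i₀) ∧
    ((∀ i, ComplexReflection.degrees W i₀ ∣ ComplexReflection.degrees W i → i = i₀) →
      List.TFAE [
        ComplexReflection.IsRegularNumber W (ComplexReflection.degrees W i₀),
        ∃ f, ComplexReflection.IsSystemOfBasicInvariants W f ∧
          ComplexReflection.IsMonicIn i₀ (ComplexReflection.discriminant W l f),
        ∀ f, ComplexReflection.IsSystemOfBasicInvariants W f →
          ComplexReflection.IsMonicIn i₀ (ComplexReflection.discriminant W l f)]) := by
  have : Finite W := hW.finite
  have hgen := hW.generated
  obtain ⟨d, f, hf⟩ := ComplexReflection.exists_isBasicSystemWithDegrees hgen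
  -- Every basic system has the same degrees `d`, so the lemmas for a fixed `d` apply to all of
  -- them.
  have hbasic : ∀ g, ComplexReflection.IsSystemOfBasicInvariants W g →
      ComplexReflection.IsBasicSystemWithDegrees W d g := by
    rintro g ⟨e, hg⟩
    rwa [← hf.degrees_eq, hg.degrees_eq]
  rw [hf.degrees_eq]
  have hiff : ComplexReflection.IsRegularNumber W (d i₀) ↔
      ∃ f, ComplexReflection.IsSystemOfBasicInvariants W f ∧
        ComplexReflection.IsMonicIn i₀ (ComplexReflection.discriminant W l f) :=
    ⟨hf.exists_isMonicIn_of_isRegularNumber hgen hl, fun ⟨g, hg, hmonic⟩ =>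
      (hbasic g hg).isRegularNumber_of_isMonicIn hgen hl hmonic⟩
  refine ⟨⟨hiff, fun g hg hmonic => ?_⟩, fun hi => ?_⟩
  · have h := ComplexReflection.mul_eq_of_coeff_single_ne_zero
      ((hbasic g hg).discriminant_isWeightedHomogeneous hgen hl) hmonic.coeff_ne_zero
    rw [eq_div_iff (Nat.cast_ne_zero.2 (hf.degree_pos i₀).ne')]
    exact_mod_cast h
  · tfae_have 1 ↔ 2 := hiff
    tfae_have 1 → 3 := fun h g hg => (hbasic g hg).isMonicIn_of_isRegularNumber hgen hl h hi
    tfae_have 3 → 2 := fun h => ⟨f, ⟨d, hf⟩, h f ⟨d, hf⟩⟩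
    tfae_finish
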